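/- Let $X$ be a Polish space and let $G$ be a Borel graph on $X$, i.e. a simple undirected graph with vertex set $X$ whose adjacency relation is a Borel subset of $X^2$. Suppose that $G$ is bipartite (it has a proper vertex 2-coloring, not necessarily Borel; equivalently, it has no odd cycles) and that every connected component of $G$ has exactly 2 ends, where an end of a connected graph $H$ is a choice, for each finite set $K$ of vertices, of a connected component $e(K)$ of $H - K$ such that $e(L)\subseteq e(K)$ whenever $K\subseteq L$. Then $$\chi'_B(G)\le \Delta(G)+1 .$$ Here $\Delta(G)$ is the supremum of the cardinalities of the neighborhoods of the vertices of $G$, and $\chi'_B(G)$, the Borel edge chromatic number, is the least cardinal $\kappa$ such that there are a standard Borel space $Y$ with exactly $\kappa$ elements and a Borel proper edge coloring of $G$ with colors in $Y$, i.e. an assignment of colors in $Y$ to all the edges of $G$ which gives distinct colors to distinct edges sharing a vertex and which is Borel as a function on the set of ordered pairs of adjacent vertices. -/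

import Mathlib

open MeasureTheory

namespace BorelGraph

universe u

/-- The graph `G` on `X` is a Borel graph: its edge set is a Borel subset of `X × X`. -/
def IsBorelGraph {X : Type u} [MeasurableSpace X] (G : SimpleGraph X) : Prop :=
  MeasurableSet {p : X × X | G.Adj p.1 p.2}

/-- The supremum (as a cardinal) of the degrees of the vertices of `G`. -/
noncomputable def supDegree {X : Type u} (G : SimpleGraph X) : Cardinal.{u} :=
  ⨆ x : X, Cardinal.mk (G.neighborSet x)

/-- An assignment `c` of colors to the (unordered) edges of `G` is Borel if it is Borel as a
function on the Borel set of ordered pairs of adjacent vertices. -/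
def IsBorelOnEdges {X : Type u} [MeasurableSpace X] {Y : Type u} [MeasurableSpace Y]
    (G : SimpleGraph X) (c : G.edgeSet → Y) : Prop :=
  Measurable fun p : {p : X × X // G.Adj p.1 p.2} => c ⟨s(p.1.1, p.1.2), p.2⟩

/-- `G` has a Borel proper edge coloring whose set of colors is a standard Borel space with
exactly `κ` elements. A proper edge coloring is a proper coloring of the line graph: distinct edges
that share a vertex get distinct colors. -/
def HasBorelEdgeColoring {X : Type u} [MeasurableSpace X] (G : SimpleGraph X)
    (κ : Cardinal.{u}) : Prop :=
  ∃ (Y : Type u) (_ : MeasurableSpace Y) (_ : StandardBorelSpace Y),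
    Cardinal.mk Y = κ ∧ ∃ c : G.lineGraph.Coloring Y, IsBorelOnEdges G c

/-- The Borel edge chromatic number: the least cardinal `κ` such that `G` has a Borel proper edge
coloring with `κ` colors. -/
noncomputable def borelEdgeChromaticNumber {X : Type u} [MeasurableSpace X]
    (G : SimpleGraph X) : Cardinal.{u} :=
  sInf {κ : Cardinal.{u} | HasBorelEdgeColoring G κ}

/-- Some Borel proper edge coloring always exists (color each edge by itself), so that the infimum
in the definition of the Borel edge chromatic number is over a nonempty set. -/
theorem exists_hasBorelEdgeColoring {X : Type u} [MeasurableSpace X] [StandardBorelSpace X]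
    (G : SimpleGraph X) : ∃ κ : Cardinal.{u}, HasBorelEdgeColoring G κ := by
  classical
  obtain ⟨f, hf⟩ := exists_measurableEmbedding_real X
  have hsymm : ∀ x y : X, (if f x ≤ f y then (x, y) else (y, x)) =
      (if f y ≤ f x then (y, x) else (x, y)) := by
    intro x y
    rcases lt_trichotomy (f x) (f y) with h | h | h
    · simp [h.le, not_le.mpr h]
    · have := hf.injective h
      subst this
      simp
    · simp [h.le, not_le.mpr h]
  let g : Sym2 X → X × X :=
    Sym2.lift ⟨fun x y => if f x ≤ f y then (x, y) else (y, x), hsymm⟩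
  have hg : ∀ e, Sym2.mk (g e).1 (g e).2 = e := by
    intro e
    induction e with
    | _ x y =>
      simp only [g, Sym2.lift_mk]
      split_ifs
      · rfl
      · exact Sym2.eq_swap
  refine ⟨_, X × X, inferInstance, inferInstance, rfl,
    SimpleGraph.Coloring.mk (fun e => g e.1) ?_, ?_⟩
  · intro e e' h heq
    apply h.ne
    apply Subtype.ext
    rw [← hg e.1, ← hg e'.1, heq]
  · change Measurable fun p : {p : X × X // G.Adj p.1 p.2} =>
      if f p.1.1 ≤ f p.1.2 then (p.1.1, p.1.2) else (p.1.2, p.1.1)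
    have h1 : Measurable fun p : {p : X × X // G.Adj p.1 p.2} => p.1.1 :=
      measurable_fst.comp measurable_subtype_coe
    have h2 : Measurable fun p : {p : X × X // G.Adj p.1 p.2} => p.1.2 :=
      measurable_snd.comp measurable_subtype_coe
    exact Measurable.ite
      (measurableSet_le (hf.measurable.comp h1) (hf.measurable.comp h2))
      (h1.prodMk h2) (h2.prodMk h1)

/-- The least cardinal in the definition of the Borel edge chromatic number is attained. -/
theorem hasBorelEdgeColoring_borelEdgeChromaticNumber {X : Type u} [MeasurableSpace X]
    [StandardBorelSpace X] (G : SimpleGraph X) :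
    HasBorelEdgeColoring G (borelEdgeChromaticNumber G) :=
  csInf_mem (exists_hasBorelEdgeColoring G)

/-- Every connected component of `G`, as a graph in its own right, has exactly two ends. -/
def AllComponentsTwoEnded {X : Type u} (G : SimpleGraph X) : Prop :=
  ∀ C : G.ConnectedComponent, Set.encard C.toSimpleGraph.end = 2

end BorelGraph

/-! Infinite `Δ` has nothing to do with ends. If all neighbourhoods are countable, Lusin–Novikov
(`sigmaInj_univ`) splits `G` into countably many Borel matchings, so `ℵ₀` colours suffice. Otherwise
some neighbourhood is an uncountable Borel set, so `Δ` is at least the continuum, which bounds the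
size of every standard Borel space of colours.

Let `Δ = d` be finite. The finite combinatorics is a form of König's theorem: in a finite bipartite
graph some matching covers all vertices of maximum degree. In a Borel graph with finite components
such matchings can be selected in a Borel way (`exists_borel_matching_cover`). To reach finite
components, `G` is cut along a Borel set `C` whose complement and whose 2-neighbourhood both induce
only finite components (`IsCutSet`). A matching `M` off `C` covers the maximum-degree vertices that
are neither in `C` nor adjacent to it; a second matching `P`, inside the 2-neighbourhood of `C`,
covers those that remain. Removing both lowers the degree bound by one (`exists_degree_reduction`).
After `d` rounds, along cut sets with pairwise disjoint 2-neighbourhoods, there are `d` matchings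
`M`, while the local matchings `P` are disjoint from each other and together form one more matching:
`d + 1` colours.

The cut sets come from the ends. A separator is a finite connected set leaving at least two infinite
pieces of its component. A maximal family of separators with disjoint `N`-neighbourhoods is built
greedily in a Borel way (`exists_isMaxSeparatorFamily`), and the cut sets are the spheres of various
radii around its members. Suppose a region `D` avoiding the spheres were infinite. Separators exist
arbitrarily far out towards an end to which `D` accumulates, so maximality puts a member `K` there
that `D` cannot enter. Then `K`, together with a finite set `L` separating the two ends, leaves
three infinite pieces: part of `D`, the part behind `K`, and the part on the other side of `L`. This
contradicts two-endedness (`finite_compl_shells`). -/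

namespace BorelGraph

universe u

/-! ### Lusin–Novikov: countable-to-one Borel maps are piecewise injective -/

section LusinNovikov

open Set

variable {X Y : Type*}

/-- Countable unions of measurable sets on which `f` is injective. -/
def SigmaInj [MeasurableSpace Y] (f : Y → X) (Z : Set Y) : Prop :=
  ∃ A : ℕ → Set Y, (∀ n, MeasurableSet (A n)) ∧ (∀ n, InjOn f (A n)) ∧ Z = ⋃ n, A n

theorem SigmaInj.measurableSet [MeasurableSpace Y] {f : Y → X} {Z : Set Y}
    (h : SigmaInj f Z) : MeasurableSet Z := by
  obtain ⟨A, hA, -, rfl⟩ := h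
  exact MeasurableSet.iUnion hA

theorem sigmaInj_iUnion [MeasurableSpace Y] {ι : Type*} [Countable ι] {f : Y → X}
    {Z : ι → Set Y} (h : ∀ i, SigmaInj f (Z i)) : SigmaInj f (⋃ i, Z i) := by
  choose A hA hinj hZ using h
  rcases isEmpty_or_nonempty ι with hι | hι
  · exact ⟨fun _ => ∅, fun _ => MeasurableSet.empty, fun _ => injOn_empty _, by simp⟩
  obtain ⟨e, he⟩ := exists_surjective_nat (ι × ℕ)
  refine ⟨fun n => A (e n).1 (e n).2, fun n => hA _ _, fun n => hinj _ _, ?_⟩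
  ext y
  simp only [hZ, mem_iUnion]
  constructor
  · rintro ⟨i, n, h⟩
    obtain ⟨k, hk⟩ := he (i, n)
    exact ⟨k, by rwa [hk]⟩
  · rintro ⟨k, h⟩
    exact ⟨_, _, h⟩

theorem SigmaInj.of_injOn [MeasurableSpace Y] {f : Y → X} {Z : Set Y}
    (hZ : MeasurableSet Z) (h : InjOn f Z) : SigmaInj f Z :=
  ⟨fun _ => Z, fun _ => hZ, fun _ => h, (iUnion_const Z).symm⟩

theorem SigmaInj.union [MeasurableSpace Y] {f : Y → X} {Z Z' : Set Y}
    (h : SigmaInj f Z) (h' : SigmaInj f Z') : SigmaInj f (Z ∪ Z') := by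
  rw [union_eq_iUnion]
  exact sigmaInj_iUnion (by rintro (_ | _) <;> assumption)

/-- A family of sets is `f`-large if, even after removing a set on which `f` is piecewise
injective, all members of the family meet a common fibre of `f`. -/
def FibreLarge [MeasurableSpace Y] (f : Y → X) {ι : Type*} (A : ι → Set Y) : Prop :=
  ∀ Z, SigmaInj f Z → ∃ x, ∀ i, ∃ y ∈ A i \ Z, f y = x

theorem analyticSet_inter [TopologicalSpace X] [T2Space X] {s t : Set X}
    (hs : AnalyticSet s) (ht : AnalyticSet t) : AnalyticSet (s ∩ t) := by
  rw [inter_eq_iInter]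
  exact AnalyticSet.iInter (by rintro (_ | _) <;> assumption)

/-- Novikov's separation theorem for finitely many analytic sets. -/
theorem exists_measurable_superset_iInter [TopologicalSpace X] [PolishSpace X] [MeasurableSpace X]
    [BorelSpace X] {ι : Type*} (s : Finset ι) (E : ι → Set X) (hE : ∀ i, AnalyticSet (E i)) :
    ∀ R : Set X, AnalyticSet R → (∀ x ∈ R, ∃ i ∈ s, x ∉ E i) →
      ∃ C : ι → Set X, (∀ i, MeasurableSet (C i)) ∧ (∀ i, E i ⊆ C i) ∧
        ∀ x ∈ R, ∃ i ∈ s, x ∉ C i := by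
  classical
  induction s using Finset.induction_on with
  | empty =>
    intro R _ h
    refine ⟨fun _ => univ, fun _ => MeasurableSet.univ, fun _ => subset_univ _, fun x hx => ?_⟩
    obtain ⟨i, hi, -⟩ := h x hx
    simp at hi
  | insert a s ha ih =>
    intro R hR h
    -- Inside `E a` the other sets already have no common point, so induction applies to `R ∩ E a`.
    -- What remains of `R` in all the `C i` is then disjoint from `E a`, and Lusin separation
    -- supplies the set `B` for the index `a`.
    obtain ⟨C, hC, hEC, hRC⟩ := ih (R ∩ E a) (analyticSet_inter hR (hE a)) (by
      rintro x ⟨hx, hxa⟩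
      obtain ⟨i, hi, hxi⟩ := h x hx
      rcases Finset.mem_insert.1 hi with rfl | hi
      · exact absurd hxa hxi
      · exact ⟨i, hi, hxi⟩)
    have hT : AnalyticSet (R ∩ ⋂ i ∈ s, C i) :=
      analyticSet_inter hR (MeasurableSet.analyticSet
        (Finset.measurableSet_biInter _ fun i _ => hC i))
    obtain ⟨B, hB1, hB2, hB⟩ := (hE a).measurablySeparable hT (by
      rw [Set.disjoint_left]
      rintro x hxa ⟨hxR, hx⟩
      obtain ⟨i, hi, hxi⟩ := hRC x ⟨hxR, hxa⟩
      exact hxi (mem_iInter₂.1 hx i hi))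
    refine ⟨fun i => if i = a then B else C i, fun i => ?_, fun i => ?_, fun x hx => ?_⟩
    · dsimp only; split_ifs
      exacts [hB, hC i]
    · dsimp only; split_ifs with h'
      · exact h' ▸ hB1
      · exact hEC i
    · by_cases hxB : x ∈ B
      · have : x ∉ ⋂ i ∈ s, C i := fun h' => Set.disjoint_left.1 hB2 ⟨hx, h'⟩ hxB
        simp only [mem_iInter, not_forall] at this
        obtain ⟨i, hi, hxi⟩ := this
        refine ⟨i, Finset.mem_insert_of_mem hi, ?_⟩
        dsimp only; rw [if_neg]
        · exact hxi
        · rintro rfl; exact ha hi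
      · exact ⟨a, Finset.mem_insert_self _ _, by simpa using hxB⟩

/-- Every member of a large finite family can be split in two small disjoint pieces in such a way
that the resulting family is still large. -/
theorem FibreLarge.exists_split [MetricSpace Y] [CompleteSpace Y] [SecondCountableTopology Y]
    [MeasurableSpace Y] [BorelSpace Y] [TopologicalSpace X] [PolishSpace X] [MeasurableSpace X]
    [BorelSpace X] {f : Y → X} (hf : Measurable f) {ι : Type*} [Finite ι] {A : ι → Set Y}
    (hA : ∀ i, MeasurableSet (A i)) (h : FibreLarge f A) {ε : ℝ} (hε : 0 < ε) :
    ∃ B : ι × Bool → Set Y, (∀ j, IsClosed (B j)) ∧ (∀ j, ∀ y ∈ B j, ∀ z ∈ B j, dist y z ≤ ε) ∧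
      (∀ i, Disjoint (B (i, false)) (B (i, true))) ∧
      FibreLarge f fun j => A j.1 ∩ B j := by
  classical
  cases nonempty_fintype ι
  rcases isEmpty_or_nonempty Y with hY | hY
  · obtain ⟨x, hx⟩ := h ∅ (SigmaInj.of_injOn MeasurableSet.empty (injOn_empty _))
    refine ⟨fun _ => ∅, fun _ => isClosed_empty, by simp, by simp, ?_⟩
    exact fun Z _ => ⟨x, fun j => (hY.false (hx j.1).choose).elim⟩
  set D := TopologicalSpace.denseSeq Y
  have hD : DenseRange D := TopologicalSpace.denseRange_denseSeq Y
  -- For each `i`, a parameter `p` records two centres from a dense sequence and a common radius.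
  -- There are only countably many parameters, so the exceptional sets of all failed choices can be
  -- united.
  let B : (ι → (ℕ × ℕ) × ℕ) → ι × Bool → Set Y := fun p j =>
    Metric.closedBall (D (if j.2 then (p j.1).1.1 else (p j.1).1.2)) (1 / ((p j.1).2 + 1))
  let good : (ι → (ℕ × ℕ) × ℕ) → Prop := fun p => ∀ i,
    2 * (1 / ((p i).2 + 1) : ℝ) ≤ ε ∧
    2 * (1 / ((p i).2 + 1) : ℝ) < dist (D (p i).1.2) (D (p i).1.1)
  by_cases hex : ∃ p, good p ∧ FibreLarge f fun j => A j.1 ∩ B p j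
  · obtain ⟨p, hp, hl⟩ := hex
    refine ⟨B p, fun j => Metric.isClosed_closedBall, ?_, ?_, hl⟩
    · intro j y hy z hz
      have h1 := Metric.mem_closedBall.1 hy
      have h2 := Metric.mem_closedBall.1 hz
      have := dist_triangle_right y z (D (if j.2 then (p j.1).1.1 else (p j.1).1.2))
      linarith [(hp j.1).1]
    · intro i
      refine Metric.closedBall_disjoint_closedBall ?_
      have := (hp i).2
      simp only [Bool.false_eq_true, if_false, if_true]
      linarith
  exfalso
  have hex' : ∀ p, ∃ Z, SigmaInj f Z ∧
      (good p → ∀ x, ∃ j : ι × Bool, ∀ y ∈ (A j.1 ∩ B p j) \ Z, f y ≠ x) := by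
    intro p
    by_cases hp : good p
    · have : ¬ FibreLarge f fun j => A j.1 ∩ B p j := fun h' => hex ⟨p, hp, h'⟩
      unfold FibreLarge at this
      push Not at this
      obtain ⟨Z, hZ, h'⟩ := this
      exact ⟨Z, hZ, fun _ => h'⟩
    · exact ⟨∅, SigmaInj.of_injOn MeasurableSet.empty (injOn_empty _), fun h' => absurd h' hp⟩
  choose Z hZ hZ' using hex'
  set W := ⋃ p, Z p
  have hW : SigmaInj f W := sigmaInj_iUnion hZ
  -- `E i` consists of the values taken at least twice on `A i \ W`. A value in every `E i` would
  -- give pairs of distinct points, hence a good choice of balls contradicting the definition of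
  -- `W`. So the `E i` have no common point, and Novikov separation encloses them in Borel sets `C
  -- i` with none either.
  let E : ι → Set X := fun i => (fun q : Y × Y => f q.1) ''
    {q | (q.1 ∈ A i \ W ∧ q.2 ∈ A i \ W) ∧ f q.1 = f q.2 ∧ q.1 ≠ q.2}
  have hE : ∀ i, AnalyticSet (E i) := by
    intro i
    refine MeasurableSet.analyticSet_image ?_ (hf.comp measurable_fst)
    have hAW : MeasurableSet (A i \ W) := (hA i).diff hW.measurableSet
    refine ((measurable_fst hAW).inter (measurable_snd hAW)).inter ?_
    exact (measurableSet_eq_fun (hf.comp measurable_fst) (hf.comp measurable_snd)).inter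
      (measurableSet_eq_fun measurable_fst measurable_snd).compl
  obtain ⟨C, hC, hEC, hCC⟩ := exists_measurable_superset_iInter Finset.univ E hE univ
    MeasurableSet.univ.analyticSet (by
      intro x _
      by_contra hx
      push Not at hx
      have hx' : ∀ i, ∃ q : Y × Y, ((q.1 ∈ A i \ W ∧ q.2 ∈ A i \ W) ∧ f q.1 = f q.2 ∧ q.1 ≠ q.2) ∧
        f q.1 = x := fun i => hx i (Finset.mem_univ i)
      choose q hq hqx using hx'
      have hp : ∀ i, ∃ p : (ℕ × ℕ) × ℕ, (2 * (1 / (p.2 + 1) : ℝ) ≤ ε ∧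
          2 * (1 / (p.2 + 1) : ℝ) < dist (D p.1.2) (D p.1.1)) ∧
          dist (q i).1 (D p.1.1) ≤ 1 / (p.2 + 1) ∧ dist (q i).2 (D p.1.2) ≤ 1 / (p.2 + 1) := by
        intro i
        have hd : 0 < dist (q i).1 (q i).2 := dist_pos.2 (hq i).2.2
        obtain ⟨k, hk⟩ := exists_nat_one_div_lt (show 0 < min (ε / 2) (dist (q i).1 (q i).2 / 4) by
          positivity)
        have hk0 : (0 : ℝ) < 1 / (k + 1) := by positivity
        obtain ⟨a, ha⟩ := hD.exists_dist_lt (q i).1 hk0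
        obtain ⟨b, hb⟩ := hD.exists_dist_lt (q i).2 hk0
        refine ⟨((a, b), k), ⟨?_, ?_⟩, ha.le, hb.le⟩
        · have := hk.trans_le (min_le_left _ _)
          dsimp only
          linarith
        · have := hk.trans_le (min_le_right _ _)
          have t1 := dist_triangle4 (q i).1 (D a) (D b) (q i).2
          rw [dist_comm (D b) (q i).2, dist_comm (D a) (D b)] at t1
          dsimp only
          linarith
      choose p hp1 hp2 hp3 using hp
      obtain ⟨j, hj⟩ := hZ' p hp1 x
      obtain ⟨i, b⟩ := j
      have hsub : ∀ y, y ∉ W → y ∉ Z p := fun y hy h' => hy (mem_iUnion.2 ⟨p, h'⟩)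
      cases b
      · refine hj (q i).2 ⟨⟨(hq i).1.2.1, ?_⟩, hsub _ (hq i).1.2.2⟩ ?_
        · exact Metric.mem_closedBall.2 (by simpa using hp3 i)
        · rw [← (hq i).2.1, hqx]
      · refine hj (q i).1 ⟨⟨(hq i).1.1.1, ?_⟩, hsub _ (hq i).1.1.2⟩ (hqx i)
        exact Metric.mem_closedBall.2 (by simpa using hp2 i))
  -- Off `W` and `f ⁻¹' C i` the map is injective on `A i`, so largeness still yields a common fibre
  -- after removing all this. Its base point would lie in every `C i`.
  have hV : SigmaInj f (⋃ i, (A i \ W) \ f ⁻¹' C i) := by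
    refine sigmaInj_iUnion fun i => SigmaInj.of_injOn
      (((hA i).diff hW.measurableSet).diff (hf (hC i))) ?_
    intro y hy z hz hyz
    by_contra hne
    exact hy.2 (hEC i ⟨(y, z), ⟨⟨hy.1, hz.1⟩, hyz, hne⟩, rfl⟩)
  obtain ⟨x, hx⟩ := h _ (hW.union hV)
  obtain ⟨i, -, hi⟩ := hCC x trivial
  obtain ⟨y, hy, rfl⟩ := hx i
  exact hy.2 (Or.inr (mem_iUnion.2 ⟨i, ⟨hy.1, fun h' => hy.2 (Or.inl h')⟩, hi⟩))

/-- A continuous map all of whose fibres are countable is injective on each of countably many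
measurable sets covering its domain. -/
theorem sigmaInj_univ_of_continuous [MetricSpace Y] [CompleteSpace Y] [SecondCountableTopology Y]
    [MeasurableSpace Y] [BorelSpace Y] [TopologicalSpace X] [PolishSpace X] [MeasurableSpace X]
    [BorelSpace X] {f : Y → X} (hf : Continuous f) (hc : ∀ x, (f ⁻¹' {x}).Countable) :
    SigmaInj f univ := by
  classical
  by_contra hcon
  -- A Cantor scheme: level `n` is a large family indexed by binary words of length `n`, refined
  -- into disjoint pieces of diameter at most `2⁻ⁿ`. It will embed `ℕ → Bool` in a single fibre.
  let S : ℕ → Type _ := fun n =>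
    {A : (Fin n → Bool) → Set Y // (∀ s, MeasurableSet (A s)) ∧ FibreLarge f A}
  have step : ∀ n (A : S n), ∃ (A' : S (n + 1)) (B : (Fin n → Bool) × Bool → Set Y),
      (∀ j, IsClosed (B j)) ∧ (∀ j, ∀ y ∈ B j, ∀ z ∈ B j, dist y z ≤ (1 / 2 : ℝ) ^ n) ∧
      (∀ i, Disjoint (B (i, false)) (B (i, true))) ∧
      ∀ s, A'.1 s = A.1 (Fin.init s) ∩ B (Fin.init s, s (Fin.last n)) := by
    intro n A
    obtain ⟨B, hB1, hB2, hB3, hB4⟩ := A.2.2.exists_split hf.measurable A.2.1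
      (show (0 : ℝ) < (1 / 2) ^ n by positivity)
    refine ⟨⟨fun s => A.1 (Fin.init s) ∩ B (Fin.init s, s (Fin.last n)), fun s =>
      (A.2.1 _).inter (hB1 _).measurableSet, fun Z hZ => ?_⟩, B, hB1, hB2, hB3, fun _ => rfl⟩
    obtain ⟨x, hx⟩ := hB4 Z hZ
    exact ⟨x, fun s => hx (Fin.init s, s (Fin.last n))⟩
  choose next B hBc hBd hBdisj hBn using step
  have hroot : FibreLarge f (fun _ : Fin 0 → Bool => (univ : Set Y)) := by
    intro Z hZ
    have : ∃ y, y ∉ Z := by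
      by_contra h'
      push Not at h'
      exact hcon (eq_univ_of_forall h' ▸ hZ)
    obtain ⟨y, hy⟩ := this
    exact ⟨f y, fun _ => ⟨y, ⟨trivial, hy⟩, rfl⟩⟩
  let A : ∀ n, S n := fun n => Nat.rec ⟨fun _ => univ, fun _ => MeasurableSet.univ, hroot⟩ next n
  have hA : ∀ n s, (A (n + 1)).1 s =
      (A n).1 (Fin.init s) ∩ B n (A n) (Fin.init s, s (Fin.last n)) := fun n s => hBn n (A n) s
  have hpt : ∀ n, ∃ x, ∀ s, ∃ y ∈ (A n).1 s, f y = x := by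
    intro n
    obtain ⟨x, hx⟩ := (A n).2.2 ∅ (SigmaInj.of_injOn MeasurableSet.empty (injOn_empty _))
    exact ⟨x, fun s => (hx s).imp fun y hy => ⟨hy.1.1, hy.2⟩⟩
  choose x y hy hyx using hpt
  let res : ∀ n, (ℕ → Bool) → Fin n → Bool := fun n α i => α i
  let Q : (ℕ → Bool) → ℕ → Set Y := fun α n => B n (A n) (res n α, α n)
  have hAQ : ∀ α n, (A (n + 1)).1 (res (n + 1) α) = (A n).1 (res n α) ∩ Q α n :=
    fun α n => hA n _
  let u : (ℕ → Bool) → ℕ → Y := fun α n => y (n + 1) (res (n + 1) α)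
  have hanti : ∀ α, Antitone fun n => (A n).1 (res n α) := fun α =>
    antitone_nat_of_succ_le fun n => by rw [hAQ]; exact inter_subset_left
  have huQ : ∀ α n m, n ≤ m → u α m ∈ Q α n := by
    intro α n m hnm
    have h1 : u α m ∈ (A (n + 1)).1 (res (n + 1) α) :=
      hanti α (Nat.succ_le_succ hnm) (hy (m + 1) _)
    rw [hAQ] at h1
    exact h1.2
  have hlim : ∀ α, ∃ l, Filter.Tendsto (u α) Filter.atTop (nhds l) := by
    intro α
    refine cauchySeq_tendsto_of_complete
      (cauchySeq_of_le_geometric (1 / 2) 1 (by norm_num) fun n => ?_)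
    rw [one_mul]
    exact hBd n (A n) _ _ (huQ α n n le_rfl) _ (huQ α n (n + 1) n.le_succ)
  choose l hl using hlim
  have hlQ : ∀ α n, l α ∈ Q α n := fun α n =>
    (hBc n (A n) _).mem_of_tendsto (hl α) (Filter.eventually_atTop.2 ⟨n, fun m hm => huQ α n m hm⟩)
  have hlinj : Function.Injective l := by
    intro α β hαβ
    by_contra hne
    have hex : ∃ n, α n ≠ β n := by
      by_contra h'
      push Not at h'
      exact hne (funext h')
    have hmin : res (Nat.find hex) α = res (Nat.find hex) β := by
      funext i
      have := Nat.find_min hex i.2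
      simpa using this
    have h1 := hlQ α (Nat.find hex)
    have h2 := hlQ β (Nat.find hex)
    have h3 := Nat.find_spec hex
    simp only [Q] at h1 h2
    rw [hαβ, hmin] at h1
    generalize α (Nat.find hex) = a at *
    generalize β (Nat.find hex) = b at *
    have hd := Set.disjoint_left.1 (hBdisj (Nat.find hex) (A (Nat.find hex))
      (res (Nat.find hex) β))
    cases a <;> cases b
    · exact h3 rfl
    · exact hd h1 h2
    · exact hd h2 h1
    · exact h3 rfl
  -- At each level the chosen points lie over one base point, whatever the branch. Hence `f (l α)`
  -- is the limit of a sequence independent of `α`.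
  have hfx : ∀ α, Filter.Tendsto (fun n => x (n + 1)) Filter.atTop (nhds (f (l α))) := by
    intro α
    refine ((hf.tendsto _).comp (hl α)).congr fun n => ?_
    exact hyx (n + 1) _
  have hsub : range l ⊆ f ⁻¹' {f (l fun _ => false)} := by
    rintro _ ⟨α, rfl⟩
    exact tendsto_nhds_unique (hfx α) (hfx _)
  have hcount : Countable (ℕ → Bool) := by
    have := ((hc _).mono hsub).to_subtype
    exact (rangeFactorization_injective.2 hlinj).countable
  obtain ⟨g, hg⟩ := exists_surjective_nat (ℕ → Bool)
  obtain ⟨n, hn⟩ := hg fun n => !(g n n)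
  simpa using congrFun hn n

/-- **Lusin–Novikov**: a measurable map between standard Borel spaces all of whose fibres are
countable is injective on each of countably many measurable sets covering its domain. -/
theorem sigmaInj_univ [MeasurableSpace Y] [StandardBorelSpace Y] [MeasurableSpace X]
    [StandardBorelSpace X] {f : Y → X} (hf : Measurable f) (hc : ∀ x, (f ⁻¹' {x}).Countable) :
    SigmaInj f univ := by
  let _ := upgradeStandardBorel X
  let _ := upgradeStandardBorel Y
  have hborel := BorelSpace.measurable_eq (α := Y)
  have hpolish : PolishSpace Y := inferInstance
  obtain ⟨t, hle, ht, hP⟩ := hf.exists_continuous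
  have hB : @BorelSpace Y t _ :=
    @BorelSpace.mk _ t _ (hborel.trans (borel_eq_borel_of_le hP hpolish hle).symm)
  let _ := @TopologicalSpace.upgradeIsCompletelyMetrizable Y t _
  exact sigmaInj_univ_of_continuous ht hc

end LusinNovikov

/-! ### Borel matchings, edge colourings, and the case of infinite degree -/

section Matchings

variable {X : Type u}

/-- A graph in which every vertex has at most one neighbour. -/
def IsMatchingGraph (N : SimpleGraph X) : Prop :=
  ∀ ⦃x y z⦄, N.Adj x y → N.Adj x z → y = z

theorem isBorelGraph_iff [MeasurableSpace X] {G : SimpleGraph X} :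
    IsBorelGraph G ↔ Measurable fun p : X × X => G.Adj p.1 p.2 :=
  measurableSet_setOfPred

theorem IsBorelGraph.adj [MeasurableSpace X] {G : SimpleGraph X} (hG : IsBorelGraph G)
    {Z : Type*} [MeasurableSpace Z] {f g : Z → X} (hf : Measurable f) (hg : Measurable g) :
    Measurable fun z => G.Adj (f z) (g z) :=
  (isBorelGraph_iff.1 hG).comp (hf.prodMk hg)

/-- A locally countable Borel graph is a union of countably many Borel matchings. -/
theorem exists_borel_matchings [MeasurableSpace X] [StandardBorelSpace X] {G : SimpleGraph X}
    (hG : IsBorelGraph G) (hc : ∀ x, (G.neighborSet x).Countable) :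
    ∃ N : ℕ → SimpleGraph X, (∀ k, IsBorelGraph (N k)) ∧ (∀ k, IsMatchingGraph (N k)) ∧
      (∀ k, N k ≤ G) ∧ ∀ x y, G.Adj x y → ∃ k, (N k).Adj x y := by
  obtain ⟨φ, hφ⟩ := exists_measurableEmbedding_real X
  have hstd : StandardBorelSpace {p : X × X // G.Adj p.1 p.2} := MeasurableSet.standardBorel hG
  have hfst : Measurable fun p : {p : X × X // G.Adj p.1 p.2} => p.1.1 :=
    measurable_fst.comp measurable_subtype_coe
  obtain ⟨A, hA, hinj, hcov⟩ := sigmaInj_univ hfst (by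
    intro x
    have hmaps : Set.MapsTo (fun p : {p : X × X // G.Adj p.1 p.2} => p.1.2)
        ((fun p : {p : X × X // G.Adj p.1 p.2} => p.1.1) ⁻¹' {x}) (G.neighborSet x) := by
      rintro ⟨⟨a, b⟩, h⟩ rfl
      exact h
    refine hmaps.countable_of_injOn ?_ (hc x)
    rintro ⟨⟨a, b⟩, h⟩ ha ⟨⟨a', b'⟩, h'⟩ ha' hb
    simp only [Set.mem_preimage, Set.mem_singleton_iff] at ha ha' hb
    subst ha ha' hb
    rfl)
  let E : ℕ → Set (X × X) := fun n => Subtype.val '' A n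
  have hE : ∀ n, MeasurableSet (E n) := fun n =>
    (MeasurableEmbedding.subtype_coe hG).measurableSet_image.2 (hA n)
  have hEinj : ∀ n x y z, (x, y) ∈ E n → (x, z) ∈ E n → y = z := by
    rintro n x y z ⟨⟨p, hp⟩, hpA, rfl⟩ ⟨⟨q, hq⟩, hqA, hq'⟩
    simp only at hq'
    subst hq'
    have := hinj n hpA hqA rfl
    simpa using this
  have hEG : ∀ n x y, (x, y) ∈ E n → G.Adj x y := by
    rintro n x y ⟨⟨p, hp⟩, hpA, rfl⟩
    exact hp
  have hEcov : ∀ x y, G.Adj x y → ∃ n, (x, y) ∈ E n := by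
    intro x y h
    have : (⟨(x, y), h⟩ : {p : X × X // G.Adj p.1 p.2}) ∈ ⋃ n, A n := hcov ▸ trivial
    obtain ⟨n, hn⟩ := Set.mem_iUnion.1 this
    exact ⟨n, _, hn, rfl⟩
  -- `E c.1.1` and `E c.1.2` make the edge unique from each of its ends. The rational `c.2` fixes
  -- which end a vertex can be, so that no vertex is the lower end of one edge and the upper end of
  -- another.
  let R : (ℕ × ℕ) × ℚ → X → X → Prop := fun c x y =>
    ((x, y) ∈ E c.1.1 ∧ (y, x) ∈ E c.1.2) ∧ φ x < c.2 ∧ c.2 < φ y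
  let N : (ℕ × ℕ) × ℚ → SimpleGraph X := fun c =>
    { Adj := fun x y => R c x y ∨ R c y x
      symm := ⟨fun _ _ h => h.symm⟩
      loopless := ⟨fun x h => by
        have : R c x x := by simpa using h
        exact lt_irrefl _ (this.2.1.trans this.2.2)⟩ }
  have hR : ∀ c, MeasurableSet {p : X × X | R c p.1 p.2} := by
    intro c
    refine MeasurableSet.inter (MeasurableSet.inter (hE _) (measurable_swap (hE _)))
      (MeasurableSet.inter ?_ ?_)
    · exact measurableSet_lt (hφ.measurable.comp measurable_fst) measurable_const
    · exact measurableSet_lt measurable_const (hφ.measurable.comp measurable_snd)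
  have hNB : ∀ c, IsBorelGraph (N c) := fun c => (hR c).union (measurable_swap (hR c))
  have hNM : ∀ c, IsMatchingGraph (N c) := by
    rintro c x y z (h | h) (h' | h')
    · exact hEinj _ _ _ _ h.1.1 h'.1.1
    · exact absurd (h.2.1.trans h'.2.2) (lt_irrefl _)
    · exact absurd (h'.2.1.trans h.2.2) (lt_irrefl _)
    · exact hEinj _ _ _ _ h.1.2 h'.1.2
  have hNG : ∀ c, N c ≤ G := by
    rintro c x y (h | h)
    · exact hEG _ _ _ h.1.1
    · exact hEG _ _ _ h.1.2
  have hNcov : ∀ x y, G.Adj x y → φ x < φ y → ∃ c, R c x y := by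
    intro x y h hlt
    obtain ⟨q, hq⟩ := exists_rat_btwn hlt
    obtain ⟨n, hn⟩ := hEcov x y h
    obtain ⟨m, hm⟩ := hEcov y x h.symm
    exact ⟨((n, m), q), ⟨hn, hm⟩, hq⟩
  obtain ⟨e, he⟩ := exists_surjective_nat ((ℕ × ℕ) × ℚ)
  refine ⟨fun k => N (e k), fun k => hNB _, fun k => hNM _, fun k => hNG _, fun x y h => ?_⟩
  have : ∃ c, (N c).Adj x y := by
    rcases lt_trichotomy (φ x) (φ y) with hlt | heq | hlt
    · exact (hNcov x y h hlt).imp fun c hc => Or.inl hc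
    · exact absurd (hφ.injective heq) h.ne
    · exact (hNcov y x h.symm hlt).imp fun c hc => Or.inr hc
  obtain ⟨c, hc⟩ := this
  obtain ⟨k, rfl⟩ := he c
  exact ⟨k, hc⟩

/-- A graph covered by Borel matchings indexed by a countable well-ordered set has a Borel proper
edge colouring by that set. -/
theorem hasBorelEdgeColoring_of_matchings [MeasurableSpace X] {G : SimpleGraph X} {ι : Type}
    [Countable ι] [LinearOrder ι] [WellFoundedLT ι] (N : ι → SimpleGraph X)
    (hB : ∀ k, IsBorelGraph (N k)) (hM : ∀ k, IsMatchingGraph (N k))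
    (hcov : ∀ x y, G.Adj x y → ∃ k, (N k).Adj x y) :
    HasBorelEdgeColoring G (Cardinal.lift.{u} (Cardinal.mk ι)) := by
  classical
  have hex : ∀ e : G.edgeSet, {k | e.1 ∈ (N k).edgeSet}.Nonempty := by
    rintro ⟨e, he⟩
    induction e with
    | _ x y => exact hcov x y he
  -- The colour of an edge is the least index of a matching containing it.
  let c : G.edgeSet → ι := fun e => WellFounded.min wellFounded_lt _ (hex e)
  have hc : ∀ e, e.1 ∈ (N (c e)).edgeSet := fun e => WellFounded.min_mem wellFounded_lt _ (hex e)
  have hc' : ∀ e k, e.1 ∈ (N k).edgeSet → c e ≤ k := fun e k h =>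
    not_lt.1 (WellFounded.not_lt_min wellFounded_lt {k | e.1 ∈ (N k).edgeSet} h)
  let _ : MeasurableSpace (ULift.{u} ι) := ⊤
  have : DiscreteMeasurableSpace (ULift.{u} ι) := ⟨fun _ => trivial⟩
  refine ⟨ULift.{u} ι, ⊤, inferInstance, by simp, SimpleGraph.Coloring.mk (fun e => ⟨c e⟩) ?_, ?_⟩
  · rintro e e' ⟨hne, v, hv, hv'⟩ heq
    have heq : c e = c e' := congrArg ULift.down heq
    have h1 := hc e
    have h2 := hc e'
    rw [← heq] at h2
    apply hne
    apply Subtype.ext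
    obtain ⟨w, hw⟩ := Sym2.mem_iff_exists.1 hv
    obtain ⟨w', hw'⟩ := Sym2.mem_iff_exists.1 hv'
    rw [hw] at h1 ⊢
    rw [hw'] at h2 ⊢
    have : w = w' := hM _ h1 h2
    rw [this]
  · refine measurable_to_countable' fun k => ?_
    have : (fun p : {p : X × X // G.Adj p.1 p.2} =>
        (⟨c ⟨s(p.1.1, p.1.2), p.2⟩⟩ : ULift.{u} ι)) ⁻¹' {k} =
        {p | (N k.down).Adj p.1.1 p.1.2 ∧ ∀ j : ι, j < k.down → ¬ (N j).Adj p.1.1 p.1.2} := by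
      ext p
      simp only [Set.mem_preimage, Set.mem_singleton_iff, ULift.ext_iff]
      constructor
      · intro h
        refine ⟨?_, fun j hj hadj => ?_⟩
        · rw [← h]
          exact hc ⟨s(p.1.1, p.1.2), p.2⟩
        · exact absurd (hc' ⟨s(p.1.1, p.1.2), p.2⟩ j hadj) (not_le.2 (h ▸ hj))
      · rintro ⟨h1, h2⟩
        refine le_antisymm (hc' _ _ h1) (not_lt.1 fun hlt => h2 _ hlt ?_)
        exact hc ⟨s(p.1.1, p.1.2), p.2⟩
    change MeasurableSet ((fun p : {p : X × X // G.Adj p.1 p.2} =>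
        (⟨c ⟨s(p.1.1, p.1.2), p.2⟩⟩ : ULift.{u} ι)) ⁻¹' {k})
    rw [this]
    have h1 : Measurable fun p : {p : X × X // G.Adj p.1 p.2} => p.1.1 :=
      measurable_fst.comp measurable_subtype_coe
    have h2 : Measurable fun p : {p : X × X // G.Adj p.1 p.2} => p.1.2 :=
      measurable_snd.comp measurable_subtype_coe
    refine measurableSet_setOfPred.2 (((hB _).adj h1 h2).and (Measurable.forall fun j => ?_))
    exact measurable_const.imp ((hB _).adj h1 h2).not

theorem mk_le_continuum_of_standardBorelSpace (Y : Type u) [MeasurableSpace Y]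
    [StandardBorelSpace Y] : Cardinal.mk Y ≤ Cardinal.continuum := by
  obtain ⟨f, hf⟩ := exists_measurableEmbedding_real Y
  have := Cardinal.mk_le_of_injective (α := ULift.{0} Y) (β := ULift.{u} ℝ)
    (f := fun y => ⟨f y.down⟩) fun a b h => by
      apply ULift.ext
      exact hf.injective (ULift.up_injective h)
  simpa [Cardinal.mk_real] using this

theorem continuum_le_mk_of_measurableSet [MeasurableSpace X] [StandardBorelSpace X] {s : Set X}
    (hs : MeasurableSet s) (hunc : ¬ s.Countable) : Cardinal.continuum ≤ Cardinal.mk s := by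
  have := hs.standardBorel
  have e := PolishSpace.measurableEquivOfNotCountable (α := s) (β := ULift.{u} ℝ) hunc (by
    intro h
    have : Countable ℝ := Equiv.ulift.symm.injective.countable (α := ℝ) (β := ULift.{u} ℝ)
    exact Cardinal.not_countable_real (Set.countable_univ))
  rw [Cardinal.mk_congr e.toEquiv]
  simp [Cardinal.mk_real]

theorem mk_neighborSet_le_supDegree (G : SimpleGraph X) (x : X) :
    Cardinal.mk (G.neighborSet x) ≤ supDegree G :=
  le_ciSup (f := fun x => Cardinal.mk (G.neighborSet x)) (Cardinal.bddAbove_of_small) x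

/-- The bound on the Borel edge chromatic number for graphs of infinite degree. -/
theorem borelEdgeChromaticNumber_le_of_infinite [MeasurableSpace X] [StandardBorelSpace X]
    {G : SimpleGraph X} (hG : IsBorelGraph G) (hinf : Cardinal.aleph0 ≤ supDegree G) :
    borelEdgeChromaticNumber G ≤ supDegree G := by
  by_cases hc : ∀ x, (G.neighborSet x).Countable
  · obtain ⟨N, hB, hM, -, hcov⟩ := exists_borel_matchings hG hc
    refine (csInf_le' ?_).trans hinf
    simpa using hasBorelEdgeColoring_of_matchings N hB hM hcov
  · push Not at hc
    obtain ⟨x, hx⟩ := hc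
    have hms : MeasurableSet (G.neighborSet x) :=
      measurableSet_setOfPred.2 (hG.adj measurable_const measurable_id)
    obtain ⟨Y, _, _, hY, -⟩ := hasBorelEdgeColoring_borelEdgeChromaticNumber G
    rw [← hY]
    exact (mk_le_continuum_of_standardBorelSpace Y).trans
      ((continuum_le_mk_of_measurableSet hms hx).trans (mk_neighborSet_le_supDegree G x))

end Matchings

/-! ### Countably many Borel involutions generating the graph -/

section Generators

variable {X : Type u}

/-- A countable family of measurable involutions whose graphs exhaust the adjacency relation. -/
structure IsGenerating [MeasurableSpace X] (G : SimpleGraph X) (T : ℕ → X → X) : Prop where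
  measurable : ∀ k, Measurable (T k)
  involutive : ∀ k, Function.Involutive (T k)
  adj : ∀ k x, T k x = x ∨ G.Adj x (T k x)
  cover : ∀ x y, G.Adj x y → ∃ k, T k x = y

theorem exists_measurable_involution [MeasurableSpace X] [StandardBorelSpace X]
    {N : SimpleGraph X} (hB : IsBorelGraph N) (hM : IsMatchingGraph N) :
    ∃ T : X → X, Measurable T ∧ Function.Involutive T ∧ (∀ x, T x = x ∨ N.Adj x (T x)) ∧
      ∀ x y, N.Adj x y → T x = y := by
  classical
  let T : X → X := fun x => if h : ∃ y, N.Adj x y then h.choose else x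
  have hT1 : ∀ x y, N.Adj x y → T x = y := by
    intro x y h
    have h' : ∃ y, N.Adj x y := ⟨y, h⟩
    simp only [T, dif_pos h']
    exact hM h'.choose_spec h
  have hT2 : ∀ x, (¬ ∃ y, N.Adj x y) → T x = x := fun x h => dif_neg h
  refine ⟨T, fun B hBm => ?_, fun x => ?_, fun x => ?_, hT1⟩
  · have hset : ∀ B, MeasurableSet B → MeasurableSet {x | ∃ y, N.Adj x y ∧ y ∈ B} := by
      intro B hBm
      have : {x | ∃ y, N.Adj x y ∧ y ∈ B} =
          Prod.fst '' {p : X × X | N.Adj p.1 p.2 ∧ p.2 ∈ B} := by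
        ext x
        simp
      rw [this]
      refine MeasurableSet.image_of_measurable_injOn (hB.inter (measurable_snd hBm))
        measurable_fst ?_
      rintro ⟨a, b⟩ h ⟨a', b'⟩ h' haa
      dsimp only at haa
      subst haa
      have : b = b' := hM h.1 h'.1
      rw [this]
    have : T ⁻¹' B = {x | ∃ y, N.Adj x y ∧ y ∈ B} ∪
        (B \ {x | ∃ y, N.Adj x y ∧ y ∈ Set.univ}) := by
      ext x
      by_cases h : ∃ y, N.Adj x y
      · obtain ⟨y, hy⟩ := h
        simp only [Set.mem_preimage, hT1 x y hy, Set.mem_union, Set.mem_ofPred_eq, Set.mem_sdiff,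
          Set.mem_univ, and_true]
        constructor
        · exact fun h => Or.inl ⟨y, hy, h⟩
        · rintro (⟨z, hz, hzB⟩ | h)
          · rwa [hM hy hz]
          · exact absurd ⟨y, hy⟩ h.2
      · simp only [Set.mem_preimage, hT2 x h, Set.mem_union, Set.mem_ofPred_eq, Set.mem_sdiff,
          Set.mem_univ, and_true]
        constructor
        · exact fun hx => Or.inr ⟨hx, h⟩
        · rintro (⟨z, hz, -⟩ | h')
          · exact absurd ⟨z, hz⟩ h
          · exact h'.1
    rw [this]
    exact (hset B hBm).union (hBm.diff (hset _ MeasurableSet.univ))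
  · by_cases h : ∃ y, N.Adj x y
    · obtain ⟨y, hy⟩ := h
      rw [hT1 x y hy, hT1 y x hy.symm]
    · rw [hT2 x h, hT2 x h]
  · by_cases h : ∃ y, N.Adj x y
    · obtain ⟨y, hy⟩ := h
      exact Or.inr (by rwa [hT1 x y hy])
    · exact Or.inl (hT2 x h)

theorem exists_isGenerating [MeasurableSpace X] [StandardBorelSpace X] {G : SimpleGraph X}
    (hG : IsBorelGraph G) (hc : ∀ x, (G.neighborSet x).Countable) :
    ∃ T, IsGenerating G T := by
  obtain ⟨N, hB, hM, hNG, hcov⟩ := exists_borel_matchings hG hc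
  choose T h1 h2 h3 h4 using fun k => exists_measurable_involution (hB k) (hM k)
  refine ⟨T, h1, h2, fun k x => (h3 k x).imp_right fun h => hNG k h, fun x y h => ?_⟩
  obtain ⟨k, hk⟩ := hcov x y h
  exact ⟨k, h4 k x y hk⟩

/-- The composition of the maps `T k` along a word. -/
def wordMap (T : ℕ → X → X) : List ℕ → X → X
  | [], x => x
  | k :: w, x => wordMap T w (T k x)

theorem IsGenerating.measurable_wordMap [MeasurableSpace X] {G : SimpleGraph X} {T : ℕ → X → X}
    (hT : IsGenerating G T) : ∀ w, Measurable (wordMap T w)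
  | [] => measurable_id
  | k :: w => (hT.measurable_wordMap w).comp (hT.measurable k)

theorem IsGenerating.injective_wordMap [MeasurableSpace X] {G : SimpleGraph X} {T : ℕ → X → X}
    (hT : IsGenerating G T) : ∀ w, Function.Injective (wordMap T w)
  | [] => fun _ _ h => h
  | k :: w => (hT.injective_wordMap w).comp (hT.involutive k).injective

theorem IsGenerating.reachable_wordMap [MeasurableSpace X] {G : SimpleGraph X} {T : ℕ → X → X}
    (hT : IsGenerating G T) : ∀ w x, G.Reachable x (wordMap T w x)
  | [], x => SimpleGraph.Reachable.refl x
  | k :: w, x => by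
    refine SimpleGraph.Reachable.trans ?_ (hT.reachable_wordMap w (T k x))
    rcases hT.adj k x with h | h
    · rw [h]
    · exact h.reachable

/-- Words reach every point of a component from any base point. Quantifiers over a component thereby
become countable, which is how Borel measurability is obtained throughout. -/
theorem IsGenerating.exists_wordMap [MeasurableSpace X] {G : SimpleGraph X} {T : ℕ → X → X}
    (hT : IsGenerating G T) {x y : X} (h : G.Reachable x y) : ∃ w, wordMap T w x = y := by
  obtain ⟨p⟩ := h
  induction p with
  | nil => exact ⟨[], rfl⟩
  | cons hadj _ ih =>
    obtain ⟨w, hw⟩ := ih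
    obtain ⟨k, hk⟩ := hT.cover _ _ hadj
    exact ⟨k :: w, by rw [wordMap, hk, hw]⟩

/-- Reachability in a measurable family of subgraphs of a generated graph is measurable. -/
theorem IsGenerating.measurable_reachable_family [MeasurableSpace X] [MeasurableEq X]
    {G : SimpleGraph X} {T : ℕ → X → X} (hT : IsGenerating G T) {Z : Type*} [MeasurableSpace Z]
    {H : Z → SimpleGraph X} (hH : Measurable fun p : Z × X × X => (H p.1).Adj p.2.1 p.2.2)
    (hle : ∀ z, H z ≤ G) :
    Measurable fun p : Z × X × X => (H p.1).Reachable p.2.1 p.2.2 := by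
  -- `ok w z x`: following `w` from `x` traces a walk in `H z`, without stationary steps.
  let ok : List ℕ → Z → X → Prop := fun w => List.rec (fun _ _ => True)
    (fun k _ ih z x => (H z).Adj x (T k x) ∧ ih z (T k x)) w
  have hok : ∀ w, Measurable fun p : Z × X => ok w p.1 p.2 := by
    intro w
    induction w with
    | nil => exact measurable_const
    | cons k w ih =>
      have hTk : Measurable fun p : Z × X => T k p.2 := (hT.measurable k).comp measurable_snd
      exact (hH.comp (measurable_fst.prodMk (measurable_snd.prodMk hTk))).and
        (ih.comp (measurable_fst.prodMk hTk))
  have hiff : ∀ z x y, (H z).Reachable x y ↔ ∃ w, ok w z x ∧ wordMap T w x = y := by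
    intro z x y
    constructor
    · rintro ⟨p⟩
      induction p with
      | nil => exact ⟨[], trivial, rfl⟩
      | cons hadj _ ih =>
        obtain ⟨w, hw, hw'⟩ := ih
        obtain ⟨k, hk⟩ := hT.cover _ _ (hle z hadj)
        refine ⟨k :: w, ⟨?_, ?_⟩, ?_⟩
        · rw [hk]; exact hadj
        · rw [hk]; exact hw
        · rw [wordMap, hk, hw']
    · rintro ⟨w, hw, rfl⟩
      induction w generalizing x with
      | nil => exact SimpleGraph.Reachable.refl _
      | cons k w ih => exact hw.1.reachable.trans (ih _ hw.2)
  simp only [hiff]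
  exact Measurable.exists fun w =>
    ((hok w).comp (measurable_fst.prodMk (measurable_fst.comp measurable_snd))).and
      (((hT.measurable_wordMap w).comp (measurable_fst.comp measurable_snd)).eq
        (measurable_snd.comp measurable_snd))

/-- Reachability in a Borel subgraph of a generated graph is Borel. -/
theorem IsGenerating.measurable_reachable [MeasurableSpace X] [MeasurableEq X]
    {G H : SimpleGraph X} {T : ℕ → X → X} (hT : IsGenerating G T) (hH : IsBorelGraph H)
    (hle : H ≤ G) : Measurable fun p : X × X => H.Reachable p.1 p.2 :=
  (hT.measurable_reachable_family (Z := Unit) (H := fun _ => H)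
    (hH.adj (measurable_fst.comp measurable_snd) (measurable_snd.comp measurable_snd))
    fun _ => hle).comp ((measurable_const (a := ())).prodMk measurable_id)

end Generators

/-! ### Covering the maximum-degree vertices of finite bipartite graphs -/

section FiniteMatching

open Finset in
/-- In a finite graph of maximum degree at most `d`, some permutation maps every vertex to a
neighbour or to itself, the latter only at vertices of degree less than `d`. -/
theorem exists_perm_adj_or_degree_lt {V : Type*} [Fintype V] (H : SimpleGraph V)
    [DecidableRel H.Adj] {d : ℕ} (hd : ∀ v, H.degree v ≤ d) (hpos : 0 < d) :
    ∃ σ : Equiv.Perm V, ∀ v, H.Adj v (σ v) ∨ σ v = v ∧ H.degree v < d := by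
  classical
  -- The adjacency matrix with each degree deficiency placed on the diagonal is symmetric with all
  -- row sums `d`. Double counting then gives Hall's condition for its support, and a diagonal
  -- choice is possible only at a vertex of positive deficiency.
  let W : V → V → ℕ := fun v w =>
    (if H.Adj v w then 1 else 0) + if v = w then d - H.degree v else 0
  have hsymm : ∀ v w, W v w = W w v := by
    intro v w
    simp only [W, H.adj_comm v w]
    by_cases h : v = w
    · subst h; rfl
    · rw [if_neg h, if_neg (Ne.symm h)]
  have hrow : ∀ v, ∑ w, W v w = d := by
    intro v
    simp only [W, sum_add_distrib, sum_ite_eq, mem_univ, if_true]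
    rw [sum_boole, ← SimpleGraph.card_neighborFinset_eq_degree, SimpleGraph.neighborFinset_eq_filter]
    have := hd v
    rw [← SimpleGraph.card_neighborFinset_eq_degree, SimpleGraph.neighborFinset_eq_filter] at this
    simpa using Nat.add_sub_cancel' this
  let f : V → Finset V := fun v => univ.filter fun w => W v w ≠ 0
  have hf : ∀ A : Finset V, #A ≤ #(A.biUnion f) := by
    intro A
    refine Nat.le_of_mul_le_mul_right ?_ hpos
    calc #A * d = ∑ v ∈ A, ∑ w, W v w := by simp [hrow]
      _ = ∑ v ∈ A, ∑ w ∈ A.biUnion f, W v w := by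
        refine sum_congr rfl fun v hv => (sum_subset (subset_univ _) fun w _ hw => ?_).symm
        by_contra h
        exact hw (mem_biUnion.2 ⟨v, hv, mem_filter.2 ⟨mem_univ _, h⟩⟩)
      _ ≤ ∑ v, ∑ w ∈ A.biUnion f, W v w :=
        sum_le_sum_of_subset_of_nonneg (subset_univ _) fun _ _ _ => Nat.zero_le _
      _ = ∑ w ∈ A.biUnion f, ∑ v, W w v := by
        rw [sum_comm]
        exact sum_congr rfl fun w _ => sum_congr rfl fun v _ => hsymm v w
      _ = #(A.biUnion f) * d := by simp [hrow]
  obtain ⟨g, hg, hgf⟩ := (all_card_le_biUnion_card_iff_exists_injective f).1 hf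
  refine ⟨Equiv.ofBijective g (Finite.injective_iff_bijective.1 hg), fun v => ?_⟩
  have hne : W v (g v) ≠ 0 := (mem_filter.1 (hgf v)).2
  simp only [Equiv.ofBijective_apply]
  by_cases h : H.Adj v (g v)
  · exact Or.inl h
  · right
    simp only [W, if_neg h, zero_add] at hne
    by_cases h' : v = g v
    · rw [if_pos h'] at hne
      exact ⟨h'.symm, by omega⟩
    · exact absurd (if_neg h') hne

/-- In a finite bipartite graph of maximum degree at most `d`, the vertices of degree `d` can be
covered by a matching. -/
theorem exists_matching_cover_finite {V : Type*} [Fintype V] (H : SimpleGraph V)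
    [DecidableRel H.Adj] {d : ℕ} (hd : ∀ v, H.degree v ≤ d) (hpos : 0 < d) (hbip : H.IsBipartite) :
    ∃ M ≤ H, IsMatchingGraph M ∧ ∀ v, H.degree v = d → ∃ w, M.Adj v w := by
  obtain ⟨c⟩ := hbip
  obtain ⟨σ, hσ⟩ := exists_perm_adj_or_degree_lt H hd hpos
  -- Only the edges from `v` to `σ v` with `v` of colour 0 are kept. They form a matching because
  -- `σ` is injective. A vertex of degree `d` is covered through `σ` if it has colour 0 and through
  -- `σ.symm` otherwise.
  let R : V → V → Prop := fun v w => c v = 0 ∧ H.Adj v w ∧ σ v = w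
  have hc : ∀ {v w}, R v w → c w ≠ 0 := fun h h' => c.valid h.2.1 (h.1.trans h'.symm)
  have hc1 : ∀ v, c v ≠ 0 → c v = 1 := fun v h => by omega
  have hR : ∀ v, ¬ (R v v ∨ R v v) := fun v h => (or_self_iff.1 h).2.1.ne rfl
  refine ⟨{ Adj := fun v w => R v w ∨ R w v
            symm := ⟨fun _ _ h => h.symm⟩
            loopless := ⟨hR⟩ }, ?_, ?_, ?_⟩
  · rintro v w (h | h)
    exacts [h.2.1, h.2.1.symm]
  · rintro x y z (h | h) (h' | h')
    · exact h.2.2.symm.trans h'.2.2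
    · exact absurd h.1 (hc h')
    · exact absurd h'.1 (hc h)
    · exact σ.injective (h.2.2.trans h'.2.2.symm)
  · intro v hv
    by_cases h0 : c v = 0
    · rcases hσ v with h | h
      · exact ⟨σ v, Or.inl ⟨h0, h, rfl⟩⟩
      · omega
    · have hv' : σ (σ.symm v) = v := σ.apply_symm_apply v
      rcases hσ (σ.symm v) with h | h
      · rw [hv'] at h
        refine ⟨σ.symm v, Or.inr ⟨?_, h, hv'⟩⟩
        by_contra h1
        exact c.valid h ((hc1 _ h1).trans (hc1 _ h0).symm)
      · rw [hv'] at h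
        have := h.2
        rw [← h.1] at this
        omega

/-- In a bipartite graph with degrees at most `d`, the vertices of degree `d` in a finite component
can be covered by a matching. -/
theorem exists_matching_cover_component {X : Type*} {H : SimpleGraph X} {d : ℕ}
    (hd : ∀ x, (H.neighborSet x).encard ≤ d) (hpos : 0 < d) (hbip : H.IsBipartite) (x : X)
    (hfin : {y | H.Reachable x y}.Finite) :
    ∃ M ≤ H, IsMatchingGraph M ∧
      ∀ y, H.Reachable x y → (d : ℕ∞) ≤ (H.neighborSet y).encard → ∃ z, M.Adj y z := by
  classical
  set S := {y | H.Reachable x y} with hS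
  have : Fintype S := hfin.fintype
  let H' : SimpleGraph S := H.induce S
  have hdeg : ∀ v : S, (H'.degree v : ℕ∞) = (H.neighborSet v).encard := by
    intro v
    have h1 : Subtype.val '' H'.neighborSet v = H.neighborSet v := by
      ext y
      simp only [Set.mem_image, SimpleGraph.mem_neighborSet, Subtype.exists, exists_and_right,
        exists_eq_right, H', SimpleGraph.comap_adj, Function.Embedding.subtype_apply]
      exact ⟨fun ⟨_, h⟩ => h, fun h => ⟨SimpleGraph.Reachable.trans v.2 h.reachable, h⟩⟩
    rw [← h1, Subtype.val_injective.encard_image, ← SimpleGraph.card_neighborSet_eq_degree,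
      Set.encard_eq_coe_toFinset_card, Set.toFinset_card]
  have hbip' : H'.IsBipartite := hbip.of_hom (SimpleGraph.Embedding.comap _ H).toHom
  obtain ⟨M, hMle, hM, hMc⟩ := exists_matching_cover_finite H'
    (fun v => by have := hd v; rw [← hdeg] at this; exact_mod_cast this) hpos hbip'
  refine ⟨M.map (Function.Embedding.subtype _), ?_, ?_, ?_⟩
  · rintro a b ⟨-, a', b', h, rfl, rfl⟩
    exact hMle h
  · rintro a b b' ⟨-, a1, b1, h, rfl, rfl⟩ ⟨-, a2, b2, h', ha, rfl⟩
    have : a2 = a1 := Subtype.ext ha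
    subst this
    rw [hM h h']
  · intro y hy hyd
    obtain ⟨z, hz⟩ := hMc ⟨y, hy⟩ (by
      have h1 : ((H'.degree ⟨y, hy⟩ : ℕ) : ℕ∞) = d := (hdeg ⟨y, hy⟩).trans (le_antisymm (hd y) hyd)
      exact_mod_cast h1)
    exact ⟨z, fun h => hz.ne (Subtype.ext h), ⟨y, hy⟩, z, hz, rfl, rfl⟩

end FiniteMatching

/-! ### Borel selection of matchings in graphs with finite components -/

section Selection

variable {X : Type u} [MeasurableSpace X]

/-- The relation coded by a finite set of pairs of words at a base point. -/
def CodedRel (T : ℕ → X → X) (w : Finset (List ℕ × List ℕ)) (x y z : X) : Prop :=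
  ∃ p ∈ w, wordMap T p.1 x = y ∧ wordMap T p.2 x = z

/-- The code `w` describes, at the base point `x`, a matching in the component of `x` in `H` that
covers the points of `D` in this component. -/
def IsMatchingCode (T : ℕ → X → X) (H : SimpleGraph X) (D : Set X)
    (w : Finset (List ℕ × List ℕ)) (x : X) : Prop :=
  (∀ p ∈ w, H.Reachable x (wordMap T p.1 x) ∧ H.Adj (wordMap T p.1 x) (wordMap T p.2 x)) ∧
  (∀ p ∈ w, ∃ q ∈ w, wordMap T q.1 x = wordMap T p.2 x ∧ wordMap T q.2 x = wordMap T p.1 x) ∧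
  (∀ p ∈ w, ∀ q ∈ w, wordMap T p.1 x = wordMap T q.1 x → wordMap T p.2 x = wordMap T q.2 x) ∧
  ∀ u, H.Reachable x (wordMap T u x) → wordMap T u x ∈ D →
    ∃ p ∈ w, wordMap T p.1 x = wordMap T u x

variable [StandardBorelSpace X] {G H : SimpleGraph X} {T : ℕ → X → X}

theorem IsGenerating.measurable_isMatchingCode (hT : IsGenerating G T) (hH : IsBorelGraph H)
    (hle : H ≤ G) {D : Set X} (hD : MeasurableSet D) (w : Finset (List ℕ × List ℕ)) :
    Measurable (IsMatchingCode T H D w) := by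
  have hm := hT.measurable_wordMap
  have hr : ∀ u, Measurable fun x => H.Reachable x (wordMap T u x) := fun u =>
    (hT.measurable_reachable hH hle).comp (measurable_id.prodMk (hm u))
  refine Measurable.and (Measurable.forall fun p => measurable_const.imp ?_)
    (Measurable.and (Measurable.forall fun p => measurable_const.imp ?_) (Measurable.and
      (Measurable.forall fun p => measurable_const.imp ?_) (Measurable.forall fun u => ?_)))
  · exact (hr _).and (hH.adj (hm _) (hm _))
  · exact Measurable.exists fun q => measurable_const.and
      (((hm _).eq (hm _)).and ((hm _).eq (hm _)))
  · exact Measurable.forall fun q => measurable_const.imp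
      (((hm _).eq (hm _)).imp ((hm _).eq (hm _)))
  · refine (hr u).imp (Measurable.imp (measurableSet_setOfPred.1 (hm u hD)) ?_)
    exact Measurable.exists fun q => measurable_const.and ((hm _).eq (hm _))

/-- A Borel set of vertices that can be covered by a matching in each component of a Borel graph
with finite components can be covered by a Borel matching. -/
theorem IsGenerating.exists_borel_matching_cover (hT : IsGenerating G T) (hH : IsBorelGraph H)
    (hle : H ≤ G) (hfin : ∀ x, {y | H.Reachable x y}.Finite) {D : Set X} (hD : MeasurableSet D)
    (hex : ∀ x, ∃ M ≤ H, IsMatchingGraph M ∧ ∀ y, H.Reachable x y → y ∈ D → ∃ z, M.Adj y z) :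
    ∃ M ≤ H, IsBorelGraph M ∧ IsMatchingGraph M ∧ ∀ y ∈ D, ∃ z, M.Adj y z := by
  classical
  obtain ⟨φ, hφ⟩ := exists_measurableEmbedding_real X
  have hm := hT.measurable_wordMap
  have hVm := hT.measurable_isMatchingCode hH hle hD
  have hr : Measurable fun p : X × X => H.Reachable p.1 p.2 := hT.measurable_reachable hH hle
  set V := IsMatchingCode T H D
  -- A canonical choice in each component: `w` is the first code valid at any of its points, and `x`
  -- is the `φ`-least point where `w` is valid. Such an `x` exists because components are finite.
  let Ch : Finset (List ℕ × List ℕ) → X → Prop := fun w x => V w x ∧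
    ∀ u, H.Reachable x (wordMap T u x) →
      (∀ w', Encodable.encode w' < Encodable.encode w → ¬ V w' (wordMap T u x)) ∧
      (V w (wordMap T u x) → φ x ≤ φ (wordMap T u x))
  have hChm : ∀ w, Measurable (Ch w) := by
    intro w
    refine (hVm w).and (Measurable.forall fun u => Measurable.imp ?_ (Measurable.and ?_ ?_))
    · exact hr.comp (measurable_id.prodMk (hm u))
    · exact Measurable.forall fun w' => measurable_const.imp ((hVm w').comp (hm u)).not
    · exact ((hVm w).comp (hm u)).imp (measurableSet_setOfPred.1
        (measurableSet_le hφ.measurable (hφ.measurable.comp (hm u))))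
  have hCh : ∀ {w x}, Ch w x → ∀ y, H.Reachable x y →
      (∀ w', Encodable.encode w' < Encodable.encode w → ¬ V w' y) ∧ (V w y → φ x ≤ φ y) := by
    intro w x h y hy
    obtain ⟨u, rfl⟩ := hT.exists_wordMap (hy.mono hle)
    exact h.2 u hy
  have huniq : ∀ {w x w' x'}, Ch w x → Ch w' x' → H.Reachable x x' → w = w' ∧ x = x' := by
    intro w x w' x' h h' hxx
    have hw : w = w' := by
      apply Encodable.encode_injective
      refine le_antisymm (not_lt.1 fun hlt => ?_) (not_lt.1 fun hlt => ?_)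
      · exact (hCh h x' hxx).1 _ hlt h'.1
      · exact (hCh h' x hxx.symm).1 _ hlt h.1
    subst hw
    exact ⟨rfl, hφ.injective (le_antisymm ((hCh h x' hxx).2 h'.1) ((hCh h' x hxx.symm).2 h.1))⟩
  have hexV : ∀ x, ∃ w, V w x := by
    intro x
    obtain ⟨M, hMle, hM, hMc⟩ := hex x
    have hwd : ∀ y, ∃ u, H.Reachable x y → wordMap T u x = y := by
      intro y
      by_cases h : H.Reachable x y
      · exact (hT.exists_wordMap (h.mono hle)).imp fun u hu _ => hu
      · exact ⟨[], fun h' => absurd h' h⟩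
    choose wd hwd using hwd
    let Ed : Set (X × X) := {p | H.Reachable x p.1 ∧ M.Adj p.1 p.2}
    have hr2 : ∀ p ∈ Ed, H.Reachable x p.2 := fun p hp => hp.1.trans (hMle hp.2).reachable
    have hEd : Ed.Finite := ((hfin x).prod (hfin x)).subset fun p hp => ⟨hp.1, hr2 p hp⟩
    let w : Finset (List ℕ × List ℕ) := hEd.toFinset.image fun p => (wd p.1, wd p.2)
    have hw : ∀ q ∈ w, ∃ p ∈ Ed, wordMap T q.1 x = p.1 ∧ wordMap T q.2 x = p.2 := by
      intro q hq
      obtain ⟨p, hp, rfl⟩ := Finset.mem_image.1 hq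
      have hp := hEd.mem_toFinset.1 hp
      exact ⟨p, hp, hwd _ hp.1, hwd _ (hr2 p hp)⟩
    have hw' : ∀ p ∈ Ed, ∃ q ∈ w, wordMap T q.1 x = p.1 ∧ wordMap T q.2 x = p.2 := by
      intro p hp
      exact ⟨_, Finset.mem_image.2 ⟨p, hEd.mem_toFinset.2 hp, rfl⟩, hwd _ hp.1, hwd _ (hr2 p hp)⟩
    refine ⟨w, ?_, ?_, ?_, ?_⟩
    · intro q hq
      obtain ⟨p, hp, h1, h2⟩ := hw q hq
      rw [h1, h2]
      exact ⟨hp.1, hMle hp.2⟩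
    · intro q hq
      obtain ⟨p, hp, h1, h2⟩ := hw q hq
      obtain ⟨q', hq', h3, h4⟩ := hw' (p.2, p.1) ⟨hr2 p hp, hp.2.symm⟩
      exact ⟨q', hq', h3.trans h2.symm, h4.trans h1.symm⟩
    · intro q hq q' hq' heq
      obtain ⟨p, hp, h1, h2⟩ := hw q hq
      obtain ⟨p', hp', h1', h2'⟩ := hw q' hq'
      rw [h1, h1'] at heq
      rw [h2, h2']
      have h3 := hp'.2
      rw [← heq] at h3
      exact hM hp.2 h3
    · intro u hu huD
      obtain ⟨z, hz⟩ := hMc _ hu huD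
      obtain ⟨q, hq, h1, -⟩ := hw' (wordMap T u x, z) ⟨hu, hz⟩
      exact ⟨q, hq, h1⟩
  have hexCh : ∀ y, ∃ x w, H.Reachable y x ∧ Ch w x := by
    intro y
    have hne : ∃ n, ∃ w x, Encodable.encode w = n ∧ H.Reachable y x ∧ V w x := by
      obtain ⟨w, hw⟩ := hexV y
      exact ⟨_, w, y, rfl, SimpleGraph.Reachable.refl y, hw⟩
    obtain ⟨w, x, hwn, hyx, hVx⟩ := Nat.find_spec hne
    obtain ⟨x', ⟨hyx', hVx'⟩, hmin⟩ := Set.exists_min_image {x | H.Reachable y x ∧ V w x} φ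
      ((hfin y).subset fun x hx => hx.1) ⟨x, hyx, hVx⟩
    refine ⟨x', w, hyx', hVx', fun u hu => ⟨fun w' hlt hV => ?_, fun hV => ?_⟩⟩
    · rw [hwn] at hlt
      exact Nat.find_min hne hlt ⟨w', _, rfl, hyx'.trans hu, hV⟩
    · exact hmin _ ⟨hyx'.trans hu, hV⟩
  let A : X → X → Prop := fun y z => ∃ u w, H.Reachable y (wordMap T u y) ∧
    Ch w (wordMap T u y) ∧ CodedRel T w (wordMap T u y) y z
  have hA : ∀ {y z}, A y z ↔ ∃ x w, H.Reachable y x ∧ Ch w x ∧ CodedRel T w x y z := by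
    intro y z
    constructor
    · rintro ⟨u, w, h⟩
      exact ⟨_, w, h⟩
    · rintro ⟨x, w, h⟩
      obtain ⟨u, rfl⟩ := hT.exists_wordMap (h.1.mono hle)
      exact ⟨u, w, h⟩
  have hAH : ∀ {y z}, A y z → H.Adj y z := by
    intro y z h
    obtain ⟨x, w, -, hC, p, hp, rfl, rfl⟩ := hA.1 h
    exact (hC.1.1 p hp).2
  have hAs : ∀ {y z}, A y z → A z y := by
    intro y z h
    have hadj := hAH h
    obtain ⟨x, w, hyx, hC, p, hp, h1, h2⟩ := hA.1 h
    obtain ⟨q, hq, h3, h4⟩ := hC.1.2.1 p hp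
    exact hA.2 ⟨x, w, hadj.symm.reachable.trans hyx, hC, q, hq, h3.trans h2, h4.trans h1⟩
  refine ⟨{ Adj := A
            symm := ⟨fun _ _ h => hAs h⟩
            loopless := ⟨fun x h => (hAH h).ne rfl⟩ },
    fun _ _ h => hAH h, ?_, ?_, ?_⟩
  · refine measurableSet_setOfPred.2 (Measurable.exists fun u => Measurable.exists fun w =>
      Measurable.and ?_ (Measurable.and ?_ ?_))
    · exact hr.comp (measurable_fst.prodMk ((hm u).comp measurable_fst))
    · exact (hChm w).comp ((hm u).comp measurable_fst)
    · refine Measurable.exists fun p => measurable_const.and (Measurable.and ?_ ?_)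
      · exact ((hm p.1).comp ((hm u).comp measurable_fst)).eq measurable_fst
      · exact ((hm p.2).comp ((hm u).comp measurable_fst)).eq measurable_snd
  · intro y z z' h h'
    obtain ⟨x, w, hyx, hC, p, hp, h1, h2⟩ := hA.1 h
    obtain ⟨x', w', hyx', hC', p', hp', h1', h2'⟩ := hA.1 h'
    obtain ⟨rfl, rfl⟩ := huniq hC hC' (hyx.symm.trans hyx')
    rw [← h2, ← h2']
    exact hC.1.2.2.1 p hp p' hp' (h1.trans h1'.symm)
  · intro y hy
    obtain ⟨x, w, hyx, hC⟩ := hexCh y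
    obtain ⟨u, hu⟩ := hT.exists_wordMap (hyx.symm.mono hle)
    obtain ⟨p, hp, h⟩ := hC.1.2.2.2 u (hu ▸ hyx.symm) (hu ▸ hy)
    exact ⟨_, hA.2 ⟨x, w, hyx, hC, p, hp, h.trans hu, rfl⟩⟩

end Selection

/-! ### Edge colouring along cut sets -/

section CutColoring

variable {X : Type u}

/-- The spanning subgraph of `G` formed by the edges with both ends in `A`. -/
def within (G : SimpleGraph X) (A : Set X) : SimpleGraph X where
  Adj x y := G.Adj x y ∧ x ∈ A ∧ y ∈ A
  symm := ⟨fun _ _ h => ⟨h.1.symm, h.2.2, h.2.1⟩⟩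
  loopless := ⟨fun _ h => h.1.ne rfl⟩

theorem within_le (G : SimpleGraph X) (A : Set X) : within G A ≤ G := fun _ _ h => h.1

theorem within_mono {G H : SimpleGraph X} (h : H ≤ G) {A B : Set X} (hAB : A ⊆ B) :
    within H A ≤ within G B := fun _ _ h' => ⟨h h'.1, hAB h'.2.1, hAB h'.2.2⟩

/-- The set of points at distance at most one from `A`. -/
def thicken (G : SimpleGraph X) (A : Set X) : Set X := {y | y ∈ A ∨ ∃ z ∈ A, G.Adj z y}

theorem subset_thicken (G : SimpleGraph X) (A : Set X) : A ⊆ thicken G A := fun _ h => Or.inl h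

theorem mem_thicken_of_adj {G : SimpleGraph X} {A : Set X} {x y : X} (hx : x ∈ A)
    (h : G.Adj x y) : y ∈ thicken G A := Or.inr ⟨x, hx, h⟩

variable [MeasurableSpace X]

theorem IsBorelGraph.within {G : SimpleGraph X} (hG : IsBorelGraph G) {A : Set X}
    (hA : MeasurableSet A) : IsBorelGraph (within G A) :=
  MeasurableSet.inter hG ((measurable_fst hA).inter (measurable_snd hA))

theorem IsBorelGraph.sdiff {G H : SimpleGraph X} (hG : IsBorelGraph G) (hH : IsBorelGraph H) :
    IsBorelGraph (G \ H) := MeasurableSet.diff hG hH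

theorem IsBorelGraph.sup {G H : SimpleGraph X} (hG : IsBorelGraph G) (hH : IsBorelGraph H) :
    IsBorelGraph (G ⊔ H) := MeasurableSet.union hG hH

variable {G H : SimpleGraph X} {T : ℕ → X → X}

theorem IsGenerating.mem_thicken_iff (hT : IsGenerating G T) {A : Set X} {y : X} :
    y ∈ thicken G A ↔ y ∈ A ∨ ∃ k, T k y ∈ A := by
  constructor
  · rintro (h | ⟨z, hz, h⟩)
    · exact Or.inl h
    · obtain ⟨k, rfl⟩ := hT.cover y z h.symm
      exact Or.inr ⟨k, hz⟩
  · rintro (h | ⟨k, h⟩)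
    · exact Or.inl h
    · rcases hT.adj k y with h' | h'
      · exact Or.inl (h' ▸ h)
      · exact Or.inr ⟨_, h, h'.symm⟩

theorem IsGenerating.measurableSet_thicken (hT : IsGenerating G T) {A : Set X}
    (hA : MeasurableSet A) : MeasurableSet (thicken G A) := by
  have : thicken G A = A ∪ ⋃ k, T k ⁻¹' A := by
    ext y
    rw [hT.mem_thicken_iff]
    simp
  rw [this]
  exact hA.union (MeasurableSet.iUnion fun k => hT.measurable k hA)

theorem IsGenerating.measurableSet_le_degree [MeasurableEq X] (hT : IsGenerating G T)
    (hH : IsBorelGraph H) (hle : H ≤ G) (n : ℕ) :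
    MeasurableSet {x | (n : ℕ∞) ≤ (H.neighborSet x).encard} := by
  have : {x | (n : ℕ∞) ≤ (H.neighborSet x).encard} = {x | ∃ a : Fin n → ℕ,
      (∀ i, H.Adj x (T (a i) x)) ∧ ∀ i j, i ≠ j → ¬ T (a i) x = T (a j) x} := by
    ext x
    constructor
    · intro h
      obtain ⟨t, ht, htn⟩ := Set.exists_subset_encard_eq h
      have hfin : t.Finite := Set.finite_of_encard_eq_coe htn
      have hcard : Nat.card t = n := by
        rw [Nat.card_coe_set_eq, Set.ncard, htn]; rfl
      have := hfin.to_subtype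
      let e : Fin n ≃ t := (finCongr hcard.symm).trans (Finite.equivFin t).symm
      choose k hk using fun i => hT.cover x (e i) (hle (ht (e i).2))
      refine ⟨k, fun i => ?_, fun i j hij h' => hij ?_⟩
      · rw [hk]; exact ht (e i).2
      · rw [hk, hk] at h'
        exact e.injective (Subtype.ext h')
    · rintro ⟨a, ha, hne⟩
      have hinj : Function.Injective fun i => T (a i) x := by
        intro i j hij
        by_contra h'
        exact hne i j h' hij
      have hsub : Set.range (fun i => T (a i) x) ⊆ H.neighborSet x := by
        rintro _ ⟨i, rfl⟩
        exact ha i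
      refine le_trans ?_ (Set.encard_le_encard hsub)
      rw [← Set.image_univ, hinj.encard_image]
      simp
  rw [this]
  refine measurableSet_setOfPred.2 (Measurable.exists fun a => Measurable.and
    (Measurable.forall fun i => hH.adj measurable_id (hT.measurable _))
    (Measurable.forall fun i => Measurable.forall fun j => measurable_const.imp
      ((hT.measurable _).eq (hT.measurable _)).not))

/-- A set of vertices that separates `G` into finite pieces and whose neighbourhood consists of
finite pieces. -/
structure IsCutSet (G : SimpleGraph X) (C : Set X) : Prop where
  measurableSet : MeasurableSet C
  finite_compl : ∀ x, {y | (within G Cᶜ).Reachable x y}.Finite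
  finite_thicken : ∀ x, {y | (within G (thicken G (thicken G C))).Reachable x y}.Finite

variable [StandardBorelSpace X]

theorem IsGenerating.exists_matching_cover_max_degree (hT : IsGenerating G T)
    (hH : IsBorelGraph H) (hle : H ≤ G) (hbip : H.IsBipartite)
    (hfin : ∀ x, {y | H.Reachable x y}.Finite) {d : ℕ}
    (hd : ∀ x, (H.neighborSet x).encard ≤ (d + 1 : ℕ)) :
    ∃ M ≤ H, IsBorelGraph M ∧ IsMatchingGraph M ∧
      ∀ x, ((d + 1 : ℕ) : ℕ∞) ≤ (H.neighborSet x).encard → ∃ z, M.Adj x z :=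
  hT.exists_borel_matching_cover hH hle hfin (hT.measurableSet_le_degree hH hle (d + 1)) fun x =>
    exists_matching_cover_component hd d.succ_pos hbip x (hfin x)

/-- Given a cut set, the maximum degree of a bipartite Borel subgraph can be lowered by one by
removing two Borel matchings, one of which is contained in a neighbourhood of the cut set. -/
theorem IsGenerating.exists_degree_reduction (hT : IsGenerating G T) (hH : IsBorelGraph H)
    (hle : H ≤ G) (hbip : H.IsBipartite) {d : ℕ}
    (hd : ∀ x, (H.neighborSet x).encard ≤ (d + 1 : ℕ)) {C : Set X} (hC : IsCutSet G C) :
    ∃ M P H' : SimpleGraph X, (IsBorelGraph M ∧ IsMatchingGraph M) ∧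
      (IsBorelGraph P ∧ IsMatchingGraph P ∧ P ≤ within G (thicken G (thicken G C))) ∧
      (IsBorelGraph H' ∧ H' ≤ H ∧ ∀ x, (H'.neighborSet x).encard ≤ d) ∧
      ∀ x y, H.Adj x y → M.Adj x y ∨ P.Adj x y ∨ H'.Adj x y := by
  classical
  set B := thicken G (thicken G C)
  have hBm : MeasurableSet B := hT.measurableSet_thicken (hT.measurableSet_thicken hC.1)
  have hsub : ∀ {K : SimpleGraph X}, K ≤ H → ∀ x, (K.neighborSet x).encard ≤ (d + 1 : ℕ) :=
    fun hK x => (Set.encard_le_encard fun y hy => hK hy).trans (hd x)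
  have hbsub : ∀ {K : SimpleGraph X}, K ≤ H → K.IsBipartite := fun hK =>
    hbip.of_hom (SimpleGraph.Hom.ofLE hK)
  have h1 : within H Cᶜ ≤ H := within_le _ _
  obtain ⟨M, hMle, hMB, hMM, hMc⟩ := hT.exists_matching_cover_max_degree
    (hH.within hC.1.compl) (h1.trans hle) (hbsub h1)
    (fun x => (hC.2 x).subset fun y hy => hy.mono (within_mono hle subset_rfl)) (hsub h1)
  have h2 : within (H \ M) B ≤ H := (within_le _ _).trans sdiff_le
  obtain ⟨P, hPle, hPB, hPM, hPc⟩ := hT.exists_matching_cover_max_degree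
    ((hH.sdiff hMB).within hBm) (h2.trans hle) (hbsub h2)
    (fun x => (hC.3 x).subset fun y hy => hy.mono (within_mono (sdiff_le.trans hle) subset_rfl))
    (hsub h2)
  refine ⟨M, P, (H \ M) \ P, ⟨hMB, hMM⟩,
    ⟨hPB, hPM, hPle.trans (within_mono (sdiff_le.trans hle) subset_rfl)⟩,
    ⟨(hH.sdiff hMB).sdiff hPB, sdiff_le.trans sdiff_le, fun x => ?_⟩, fun x y h => ?_⟩
  · by_contra hlt
    have hge : ((d + 1 : ℕ) : ℕ∞) ≤ (((H \ M) \ P).neighborSet x).encard := by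
      have := Order.add_one_le_of_lt (not_le.1 hlt)
      exact_mod_cast this
    have hss : ((H \ M) \ P).neighborSet x ⊆ H.neighborSet x := fun y hy => hy.1.1
    have heq : ((H \ M) \ P).neighborSet x = H.neighborSet x :=
      Set.Finite.eq_of_subset_of_encard_le
        (Set.finite_of_encard_le_coe ((Set.encard_le_encard hss).trans (hd x))) hss
        ((hd x).trans hge)
    have hno : ∀ z, H.Adj x z → ¬ M.Adj x z ∧ ¬ P.Adj x z := by
      intro z hz
      have hz' : z ∈ ((H \ M) \ P).neighborSet x := heq ▸ hz
      exact ⟨hz'.1.2, hz'.2⟩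
    -- A vertex still of degree `d + 1` has lost no edge. If it is in `C` or adjacent to it, all its
    -- edges lie inside `B`, so `P` covered it. Otherwise all its edges avoid `C`, so `M` covered
    -- it. This is why `B` must be a double thickening.
    by_cases hx : x ∈ thicken G C
    · obtain ⟨z, hz⟩ := hPc x (hge.trans (Set.encard_le_encard fun y hy =>
        ⟨hy.1, subset_thicken _ _ hx, mem_thicken_of_adj hx (hle hy.1.1)⟩))
      exact (hno z (h2 (hPle hz))).2 hz
    · obtain ⟨z, hz⟩ := hMc x (hge.trans (Set.encard_le_encard fun y hy =>
        ⟨hy.1.1, fun h => hx (subset_thicken _ _ h),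
          fun h => hx (mem_thicken_of_adj h (hle hy.1.1).symm)⟩))
      exact (hno z (h1 (hMle hz))).1 hz
  · by_cases hM : M.Adj x y
    · exact Or.inl hM
    · by_cases hP : P.Adj x y
      · exact Or.inr (Or.inl hP)
      · exact Or.inr (Or.inr ⟨⟨h, hM⟩, hP⟩)

/-- Given sufficiently many cut sets that are far apart, a bipartite Borel graph of maximum degree
at most `d` is a union of `d + 1` Borel matchings. -/
theorem IsGenerating.exists_matchings_of_cutSets (hT : IsGenerating G T) {C : ℕ → Set X} {D : ℕ}
    (hC : ∀ i < D, IsCutSet G (C i))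
    (hdisj : ∀ i < D, ∀ j < D, i ≠ j →
      Disjoint (thicken G (thicken G (C i))) (thicken G (thicken G (C j)))) :
    ∀ d ≤ D, ∀ H : SimpleGraph X, IsBorelGraph H → H ≤ G → H.IsBipartite →
      (∀ x, (H.neighborSet x).encard ≤ d) →
      ∃ (N : ℕ → SimpleGraph X) (P : SimpleGraph X),
        (∀ i, IsBorelGraph (N i) ∧ IsMatchingGraph (N i)) ∧ IsBorelGraph P ∧ IsMatchingGraph P ∧
        (∀ x y, P.Adj x y → ∃ i < d, x ∈ thicken G (thicken G (C i))) ∧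
        ∀ x y, H.Adj x y → P.Adj x y ∨ ∃ i < d, (N i).Adj x y := by
  have hbot : IsBorelGraph (⊥ : SimpleGraph X) ∧ IsMatchingGraph (⊥ : SimpleGraph X) :=
    ⟨MeasurableSet.empty, fun x y z h => h.elim⟩
  intro d
  induction d with
  | zero =>
    intro _ H _ _ _ hd
    refine ⟨fun _ => ⊥, ⊥, fun _ => hbot, hbot.1, hbot.2, fun x y h => h.elim, fun x y h => ?_⟩
    have : H.neighborSet x = ∅ := Set.encard_eq_zero.1 (le_antisymm (hd x) zero_le)
    exact absurd (show y ∈ H.neighborSet x from h) (this ▸ Set.notMem_empty y)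
  | succ d ih =>
    intro hdD H hH hle hbip hd
    obtain ⟨M, P, H', hM, ⟨hPB, hPM, hPle⟩, ⟨hHB, hHle, hHd⟩, hcov⟩ :=
      hT.exists_degree_reduction hH hle hbip hd (hC d hdD)
    obtain ⟨N, Q, hN, hQB, hQM, hQ, hcov'⟩ := ih (d.le_succ.trans hdD) H' hHB (hHle.trans hle)
      (hbip.of_hom (SimpleGraph.Hom.ofLE hHle)) hHd
    -- The local matchings of different rounds live on disjoint sets of vertices, so their union is
    -- again a matching and costs only one colour in total.
    have hexcl : ∀ x y z, Q.Adj x y → P.Adj x z → False := by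
      intro x y z h h'
      obtain ⟨i, hi, hx⟩ := hQ x y h
      exact Set.disjoint_left.1 (hdisj i (hi.trans hdD) d hdD hi.ne) hx (hPle h').2.1
    refine ⟨fun i => if i = d then M else N i, Q ⊔ P, fun i => ?_, hQB.sup hPB, ?_, ?_, ?_⟩
    · dsimp only
      split_ifs
      exacts [hM, hN i]
    · rintro x y z (h | h) (h' | h')
      · exact hQM h h'
      · exact (hexcl _ _ _ h h').elim
      · exact (hexcl _ _ _ h' h).elim
      · exact hPM h h'
    · rintro x y (h | h)
      · obtain ⟨i, hi, hx⟩ := hQ x y h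
        exact ⟨i, hi.trans d.lt_succ_self, hx⟩
      · exact ⟨d, d.lt_succ_self, (hPle h).2.1⟩
    · intro x y h
      rcases hcov x y h with h | h | h
      · exact Or.inr ⟨d, d.lt_succ_self, by simpa using h⟩
      · exact Or.inl (Or.inr h)
      · rcases hcov' x y h with h | ⟨i, hi, h⟩
        · exact Or.inl (Or.inl h)
        · exact Or.inr ⟨i, hi.trans d.lt_succ_self, by simpa [hi.ne] using h⟩

theorem IsGenerating.hasBorelEdgeColoring_of_cutSets (hT : IsGenerating G T)
    (hG : IsBorelGraph G) (hbip : G.IsBipartite) {d : ℕ}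
    (hd : ∀ x, (G.neighborSet x).encard ≤ d) {C : ℕ → Set X}
    (hC : ∀ i < d, IsCutSet G (C i))
    (hdisj : ∀ i < d, ∀ j < d, i ≠ j →
      Disjoint (thicken G (thicken G (C i))) (thicken G (thicken G (C j)))) :
    HasBorelEdgeColoring G ((d + 1 : ℕ) : Cardinal.{u}) := by
  obtain ⟨N, P, hN, hPB, hPM, -, hcov⟩ :=
    hT.exists_matchings_of_cutSets hC hdisj d le_rfl G hG le_rfl hbip hd
  have := hasBorelEdgeColoring_of_matchings (G := G) (ι := Fin (d + 1))
    (fun i => if i.1 < d then N i else P)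
    (fun i => by split_ifs; exacts [(hN i).1, hPB])
    (fun i => by split_ifs; exacts [(hN i).2, hPM])
    (fun x y h => by
      rcases hcov x y h with h | ⟨i, hi, h⟩
      · exact ⟨Fin.last d, by simpa using h⟩
      · exact ⟨⟨i, hi.trans d.lt_succ_self⟩, by simpa [hi] using h⟩)
  simpa using this

end CutColoring

/-! ### Ends and infinite components after removing finite sets -/

section Ends

open CategoryTheory

/-- In an infinite connected locally finite graph, every infinite component of the complement of a
finite set is chosen by some end. -/
theorem exists_end_eq {V : Type u} (H : SimpleGraph V) [H.LocallyFinite] [Fact H.Preconnected]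
    [Infinite V] (K : Finset V) (c : H.ComponentCompl K) (hc : c.supp.Infinite) :
    ∃ e ∈ H.end, e (Opposite.op K) = c := by
  let F := H.componentComplFunctor
  have hfin : ∀ j, Finite (F.obj j) := fun j => SimpleGraph.componentCompl_finite j.unop
  have hne : ∀ j, Nonempty (F.obj j) := fun j =>
    SimpleGraph.componentCompl_nonempty_of_infinite H j.unop
  -- All stages of the inverse system are finite by local finiteness. Infinite components are
  -- exactly those in the eventual range, and compactness extends each of them to a section, that
  -- is, an end.
  have hML : F.IsMittagLeffler :=
    F.isMittagLeffler_of_exists_finite_range fun j => ⟨j, 𝟙 j, Set.toFinite _⟩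
  have hs := F.surjective_toEventualRanges hML
  have hne' : ∀ j, Nonempty (F.toEventualRanges.obj j) := F.toEventualRanges_nonempty hML
  have hfin' : ∀ j, Finite (F.toEventualRanges.obj j) := fun j => Subtype.finite
  have hc' : c ∈ F.eventualRange (Opposite.op K) :=
    (SimpleGraph.infinite_iff_in_eventualRange (K := Opposite.op K) H c).1 hc
  obtain ⟨s, hs⟩ := F.toEventualRanges.eval_section_surjective_of_surjective hs
    (Opposite.op K) ⟨c, hc'⟩
  exact ⟨(F.toEventualRangesSectionsEquiv s).1, (F.toEventualRangesSectionsEquiv s).2,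
    congrArg Subtype.val hs⟩

/-- The choices of an end are compatible, so its component at `K` is in the range of every
restriction map to `K`, which characterizes the infinite components. -/
theorem infinite_supp_of_mem_end {V : Type u} {H : SimpleGraph V}
    {e : ∀ K : (Finset V)ᵒᵖ, H.componentComplFunctor.obj K} (he : e ∈ H.end) (K : Finset V) :
    SimpleGraph.ComponentCompl.supp (e (Opposite.op K)) |>.Infinite := by
  refine (SimpleGraph.ComponentCompl.infinite_iff_in_all_ranges _).mpr fun L h => ?_
  exact ⟨e (Opposite.op L), he (opHomOfLE (show Opposite.unop (Opposite.op K) ≤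
    Opposite.unop (Opposite.op L) from h))⟩

variable {X : Type u} {G : SimpleGraph X}

/-- The component of `y` in the graph that remains after removing the vertices in `L` is
infinite. -/
def InfiniteOff (G : SimpleGraph X) (L : Set X) (y : X) : Prop :=
  {z | (within G Lᶜ).Reachable y z}.Infinite

theorem reachable_within_mem {A : Set X} {x y : X} (h : (within G A).Reachable x y)
    (hx : x ∈ A) : y ∈ A := by
  obtain ⟨p⟩ := h
  induction p with
  | nil => exact hx
  | cons hadj _ ih => exact ih hadj.2.2

/-- `within` keeps all vertices, so those outside `A` become isolated rather than disappear. -/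
theorem reachable_within_eq_or_mem {A : Set X} {x y : X} (h : (within G A).Reachable x y) :
    x = y ∨ x ∈ A := by
  obtain ⟨p⟩ := h
  cases p with
  | nil => exact Or.inl rfl
  | cons hadj _ => exact Or.inr hadj.2.1

theorem InfiniteOff.notMem {L : Set X} {y : X} (h : InfiniteOff G L y) : y ∉ L := by
  intro hy
  refine h ((Set.finite_singleton y).subset fun z hz => ?_)
  rcases reachable_within_eq_or_mem hz with rfl | h'
  · rfl
  · exact absurd hy h'

theorem mem_component_of_reachable {C : G.ConnectedComponent} {x y : X} (hx : x ∈ C)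
    (h : G.Reachable x y) : y ∈ C :=
  (SimpleGraph.ConnectedComponent.sound h).symm.trans hx

/-- Translates between ends, which live on the subtype of a component, and reachability in subgraphs
of `G` on the whole of `X`. -/
theorem componentComplMk_eq_iff (C : G.ConnectedComponent) (K : Finset C) {L : Set X}
    (hKL : ∀ x : C, (x : X) ∈ L ↔ x ∈ K) {a b : C} (ha : a ∉ K) (hb : b ∉ K) :
    C.toSimpleGraph.componentComplMk (K := K) ha = C.toSimpleGraph.componentComplMk (K := K) hb ↔
      (within G Lᶜ).Reachable a b := by
  constructor
  · intro h
    have h' := SimpleGraph.ConnectedComponent.exact h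
    let f : (C.toSimpleGraph.induce (K : Set C)ᶜ) →g within G Lᶜ :=
      { toFun := fun v => v.1.1
        map_rel' := fun {v w} hvw => ⟨hvw, fun h => v.2 ((hKL _).1 h), fun h => w.2 ((hKL _).1 h)⟩ }
    exact h'.map f
  · suffices H : ∀ x y : X, (within G Lᶜ).Reachable x y → ∀ (hx : x ∈ C) (hy : y ∈ C)
        (hxK : (⟨x, hx⟩ : C) ∉ K) (hyK : (⟨y, hy⟩ : C) ∉ K),
        C.toSimpleGraph.componentComplMk (K := K) hxK =
          C.toSimpleGraph.componentComplMk (K := K) hyK from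
      fun h => H a b h a.2 b.2 ha hb
    rintro x y ⟨p⟩
    induction p with
    | nil => intros; rfl
    | @cons u v w hadj _ ih =>
      intro hx hy hxK hyK
      have hv : v ∈ C := mem_component_of_reachable hx hadj.1.reachable
      have hvK : (⟨v, hv⟩ : C) ∉ K := fun h => hadj.2.2 ((hKL _).2 h)
      rw [← ih hv hy hvK hyK]
      exact SimpleGraph.componentComplMk_eq_of_adj _ hxK hvK hadj.1

theorem infinite_supp_componentComplMk_iff (C : G.ConnectedComponent) (K : Finset C) {L : Set X}
    (hKL : ∀ x : C, (x : X) ∈ L ↔ x ∈ K) {a : C} (ha : a ∉ K) :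
    (C.toSimpleGraph.componentComplMk (K := K) ha).supp.Infinite ↔ InfiniteOff G L a := by
  have hset : Subtype.val '' (C.toSimpleGraph.componentComplMk (K := K) ha).supp =
      {z | (within G Lᶜ).Reachable a z} := by
    ext z
    constructor
    · rintro ⟨b, ⟨hb, hab⟩, rfl⟩
      exact (componentComplMk_eq_iff C K hKL ha hb).1 hab.symm
    · intro h
      have hzC : z ∈ C := mem_component_of_reachable a.2 (h.mono (within_le _ _))
      have hzL : z ∉ L := reachable_within_mem h fun h' => ha ((hKL a).1 h')
      have hzK : (⟨z, hzC⟩ : C) ∉ K := fun h' => hzL ((hKL _).2 h')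
      exact ⟨⟨z, hzC⟩, ⟨hzK, ((componentComplMk_eq_iff C K hKL ha hzK).2 h).symm⟩, rfl⟩
  rw [InfiniteOff, ← hset, Set.infinite_image_iff Subtype.val_injective.injOn]

/-- Two distinct ends differ at some finite `K`, where they choose different components, both
infinite. -/
theorem AllComponentsTwoEnded.exists_separator (hends : AllComponentsTwoEnded G) (x : X) :
    ∃ L : Set X, L.Finite ∧ ∃ a b, G.Reachable x a ∧ G.Reachable x b ∧ InfiniteOff G L a ∧
      InfiniteOff G L b ∧ ¬ (within G Lᶜ).Reachable a b := by
  classical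
  set C := G.connectedComponentMk x
  obtain ⟨e, e', hne, hee⟩ := Set.encard_eq_two.1 (hends C)
  have he : e ∈ C.toSimpleGraph.end := by rw [hee]; exact Set.mem_insert _ _
  have he' : e' ∈ C.toSimpleGraph.end := by rw [hee]; exact Set.mem_insert_of_mem _ rfl
  obtain ⟨⟨K⟩, hK⟩ := Function.ne_iff.1 hne
  have hi := infinite_supp_of_mem_end he K
  have hi' := infinite_supp_of_mem_end he' K
  obtain ⟨a, ha, hae⟩ := SimpleGraph.ComponentCompl.exists_eq_mk (e (Opposite.op K))
  obtain ⟨b, hb, hbe⟩ := SimpleGraph.ComponentCompl.exists_eq_mk (e' (Opposite.op K))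
  have hKL : ∀ y : C, (y : X) ∈ (Subtype.val '' (K : Set C) : Set X) ↔ y ∈ K := by
    intro y
    simp
  refine ⟨Subtype.val '' (K : Set C), K.finite_toSet.image _, a, b, ?_, ?_, ?_, ?_, ?_⟩
  · exact (SimpleGraph.ConnectedComponent.exact a.2).symm
  · exact (SimpleGraph.ConnectedComponent.exact b.2).symm
  · rw [← hae] at hi
    exact (infinite_supp_componentComplMk_iff C K hKL ha).1 hi
  · rw [← hbe] at hi'
    exact (infinite_supp_componentComplMk_iff C K hKL hb).1 hi'
  · intro h
    exact hK (hae.symm.trans (((componentComplMk_eq_iff C K hKL ha hb).2 h).trans hbe))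

/-- Each infinite piece is chosen by some end (`exists_end_eq`). With only two ends, two of the
three pieces share an end and therefore coincide. -/
theorem AllComponentsTwoEnded.not_three (hends : AllComponentsTwoEnded G)
    (hlf : ∀ x, (G.neighborSet x).Finite) {L : Set X} (hL : L.Finite) {a b c : X}
    (hab : G.Reachable a b) (hac : G.Reachable a c) (ha : InfiniteOff G L a)
    (hb : InfiniteOff G L b) (hc : InfiniteOff G L c) :
    (within G Lᶜ).Reachable a b ∨ (within G Lᶜ).Reachable a c ∨ (within G Lᶜ).Reachable b c := by
  classical
  set C := G.connectedComponentMk a with hCdef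
  have haC : a ∈ C := rfl
  have hbC : b ∈ C := (SimpleGraph.ConnectedComponent.sound hab).symm
  have hcC : c ∈ C := (SimpleGraph.ConnectedComponent.sound hac).symm
  have hpre : (Subtype.val ⁻¹' L : Set C).Finite := hL.preimage Subtype.val_injective.injOn
  let K : Finset C := hpre.toFinset
  have hKL : ∀ x : C, (x : X) ∈ L ↔ x ∈ K := by simp [K]
  have : C.toSimpleGraph.LocallyFinite := fun v => by
    have : (Subtype.val ⁻¹' G.neighborSet v : Set C).Finite :=
      (hlf v).preimage Subtype.val_injective.injOn
    exact (this.subset fun w hw => hw).fintype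
  have : Fact C.toSimpleGraph.Preconnected := ⟨C.connected_toSimpleGraph.preconnected⟩
  have : Infinite C := by
    have h1 : (C : Set X).Infinite := ha.mono fun z hz =>
      (SimpleGraph.ConnectedComponent.sound (hz.mono (within_le _ _))).symm
    exact h1.to_subtype
  have hnot : ∀ {y : X} (hy : y ∈ C), InfiniteOff G L y → (⟨y, hy⟩ : C) ∉ K :=
    fun hy h h' => h.notMem ((hKL _).2 h')
  have hend : ∀ {y : X} (hy : y ∈ C) (h : InfiniteOff G L y), ∃ e ∈ C.toSimpleGraph.end,
      e (Opposite.op K) = C.toSimpleGraph.componentComplMk (hnot hy h) := fun hy h =>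
    exists_end_eq _ K _ ((infinite_supp_componentComplMk_iff C K hKL (hnot hy h)).2 h)
  obtain ⟨e1, he1, h1⟩ := hend haC ha
  obtain ⟨e2, he2, h2⟩ := hend hbC hb
  obtain ⟨e3, he3, h3⟩ := hend hcC hc
  obtain ⟨f, g, -, hfg⟩ := Set.encard_eq_two.1 (hends C)
  have key : ∀ {y z : X} (hy : y ∈ C) (hz : z ∈ C) (hy' : InfiniteOff G L y)
      (hz' : InfiniteOff G L z)
      {e e' : ∀ K : (Finset C)ᵒᵖ, C.toSimpleGraph.componentComplFunctor.obj K},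
      e (Opposite.op K) = C.toSimpleGraph.componentComplMk (hnot hy hy') →
      e' (Opposite.op K) = C.toSimpleGraph.componentComplMk (hnot hz hz') → e = e' →
      (within G Lᶜ).Reachable y z := by
    rintro y z hy hz hy' hz' e _ h h' rfl
    exact (componentComplMk_eq_iff C K hKL (hnot hy hy') (hnot hz hz')).1 (h.symm.trans h')
  rw [hfg] at he1 he2 he3
  have hcases : e1 = e2 ∨ e1 = e3 ∨ e2 = e3 := by
    rcases he1 with rfl | rfl <;> rcases he2 with rfl | rfl <;> rcases he3 with rfl | rfl <;> simp
  rcases hcases with h | h | h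
  · exact Or.inl (key haC hbC ha hb h1 h2 h)
  · exact Or.inr (Or.inl (key haC hcC ha hc h1 h3 h))
  · exact Or.inr (Or.inr (key hbC hcC hb hc h2 h3 h))

end Ends

/-! ### Separators, maximal families, and the spheres around them -/

section Separators

variable {X : Type u} {G : SimpleGraph X}

/-- The set of points at distance at most `n` from `A`. -/
def nbhd (G : SimpleGraph X) (A : Set X) : ℕ → Set X
  | 0 => A
  | n + 1 => thicken G (nbhd G A n)

theorem thicken_mono {A B : Set X} (h : A ⊆ B) : thicken G A ⊆ thicken G B := by
  rintro y (hy | ⟨z, hz, hzy⟩)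
  · exact Or.inl (h hy)
  · exact Or.inr ⟨z, h hz, hzy⟩

theorem nbhd_mono (A : Set X) : Monotone (nbhd G A) :=
  monotone_nat_of_le_succ fun _ => subset_thicken _ _

theorem subset_nbhd (A : Set X) (n : ℕ) : A ⊆ nbhd G A n := nbhd_mono A n.zero_le

theorem thicken_finite (hlf : ∀ x, (G.neighborSet x).Finite) {A : Set X} (hA : A.Finite) :
    (thicken G A).Finite := by
  refine (hA.union (hA.biUnion fun z _ => hlf z)).subset ?_
  rintro y (hy | ⟨z, hz, hzy⟩)
  · exact Or.inl hy
  · exact Or.inr (Set.mem_biUnion hz hzy)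

theorem nbhd_finite (hlf : ∀ x, (G.neighborSet x).Finite) {A : Set X} (hA : A.Finite) :
    ∀ n, (nbhd G A n).Finite
  | 0 => hA
  | n + 1 => thicken_finite hlf (nbhd_finite hlf hA n)

theorem mem_thicken_symm {x y : X} (h : y ∈ thicken G {x}) : x ∈ thicken G {y} := by
  rcases h with rfl | ⟨z, rfl, h⟩
  · exact Or.inl rfl
  · exact Or.inr ⟨y, rfl, h.symm⟩

theorem exists_mem_thicken_singleton {A : Set X} {y : X} (h : y ∈ thicken G A) :
    ∃ z ∈ A, y ∈ thicken G {z} := by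
  rcases h with h | ⟨z, hz, h⟩
  · exact ⟨y, h, Or.inl rfl⟩
  · exact ⟨z, hz, Or.inr ⟨z, rfl, h⟩⟩

/-- Symmetry of the graph distance, by moving one step at a time from one set to the other. -/
theorem disjoint_nbhd_left {A B : Set X} {n : ℕ} (h : Disjoint A (nbhd G B n)) :
    Disjoint (nbhd G A n) B := by
  suffices H : ∀ n (B : Set X), (nbhd G A n ∩ B).Nonempty → (A ∩ nbhd G B n).Nonempty by
    rw [Set.disjoint_iff_inter_eq_empty, ← Set.not_nonempty_iff_eq_empty] at h ⊢
    exact fun h' => h (H n B h')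
  intro n
  induction n with
  | zero => exact fun B h => h
  | succ n ih =>
    rintro B ⟨y, hy, hyB⟩
    obtain ⟨z, hz, hyz⟩ := exists_mem_thicken_singleton hy
    obtain ⟨t, htA, ht⟩ := ih (thicken G B)
      ⟨z, hz, thicken_mono (Set.singleton_subset_iff.2 hyB) (mem_thicken_symm hyz)⟩
    refine ⟨t, htA, ?_⟩
    have hcomm : ∀ m, nbhd G (thicken G B) m = nbhd G B (m + 1) := by
      intro m
      induction m with
      | zero => rfl
      | succ m ih' => rw [nbhd, ih']; rfl
    rwa [hcomm] at ht

theorem reachable_induction {H : SimpleGraph X} {P : X → Prop} {x y : X} (h : H.Reachable x y)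
    (hP : ∀ u v, H.Adj u v → P u → P v) (hx : P x) : P y := by
  obtain ⟨p⟩ := h
  induction p with
  | nil => exact hx
  | cons hadj _ ih => exact ih (hP _ _ hadj hx)

theorem reachable_within_of_forall {S S' : Set X} {y z : X} (h : (within G S).Reachable y z)
    (hS : ∀ w, (within G S).Reachable y w → w ∈ S') : (within G S').Reachable y z := by
  have : (within G S).Reachable y z ∧ (within G S').Reachable y z := by
    refine reachable_induction (P := fun w => (within G S).Reachable y w ∧
      (within G S').Reachable y w) h ?_ ⟨.refl _, .refl _⟩
    rintro u v huv ⟨h1, h2⟩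
    have h3 := h1.trans huv.reachable
    have hadj : (within G S').Adj u v := ⟨huv.1, hS u h1, hS v h3⟩
    exact ⟨h3, h2.trans hadj.reachable⟩
  exact this.2

theorem reachable_within_mono {S S' : Set X} (h : S ⊆ S') {y z : X}
    (hr : (within G S).Reachable y z) : (within G S').Reachable y z :=
  hr.mono (within_mono le_rfl h)

theorem exists_reachable_nbhd {K : Set X} : ∀ (n : ℕ), ∀ y ∈ nbhd G K n,
    ∃ k ∈ K, (within G (nbhd G K n)).Reachable k y
  | 0, y, hy => ⟨y, hy, .refl y⟩
  | n + 1, y, hy => by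
    rcases hy with hy | ⟨z, hz, hzy⟩
    · obtain ⟨k, hk, h⟩ := exists_reachable_nbhd n y hy
      exact ⟨k, hk, reachable_within_mono (subset_thicken _ _) h⟩
    · obtain ⟨k, hk, h⟩ := exists_reachable_nbhd n z hz
      have hadj : (within G (nbhd G K (n + 1))).Adj z y :=
        ⟨hzy, subset_thicken _ _ hz, mem_thicken_of_adj hz hzy⟩
      exact ⟨k, hk, (reachable_within_mono (subset_thicken _ _) h).trans hadj.reachable⟩

/-- A point reachable from `L` and outside of `L` lies in a component of the complement of `L` that
meets the boundary of `L`. -/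
theorem exists_boundary_reachable {L : Set X} {l z : X} (hl : l ∈ L) (h : G.Reachable l z)
    (hz : z ∉ L) : ∃ k ∈ L, ∃ y, y ∉ L ∧ G.Adj k y ∧ (within G Lᶜ).Reachable y z := by
  have : z ∈ L ∨ ∃ k ∈ L, ∃ y, y ∉ L ∧ G.Adj k y ∧ (within G Lᶜ).Reachable y z := by
    refine reachable_induction (P := fun z => z ∈ L ∨
      ∃ k ∈ L, ∃ y, y ∉ L ∧ G.Adj k y ∧ (within G Lᶜ).Reachable y z) h ?_ (Or.inl hl)
    intro u v huv hu
    by_cases hv : v ∈ L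
    · exact Or.inl hv
    right
    by_cases huL : u ∈ L
    · exact ⟨u, huL, v, hv, huv, .refl v⟩
    · obtain ⟨k, hk, y, hy, hky, hyu⟩ := hu.resolve_left huL
      have hadj : (within G Lᶜ).Adj u v := ⟨huv, huL, hv⟩
      exact ⟨k, hk, y, hy, hky, hyu.trans hadj.reachable⟩
  exact this.resolve_left hz

/-- Removing a finite set from a locally finite connected graph, some component of what remains
contains infinitely many points of a given infinite set. -/
theorem exists_infinite_component (hlf : ∀ x, (G.neighborSet x).Finite) {L A : Set X}
    (hL : L.Finite) {l : X} (hl : l ∈ L) (hA : A.Infinite) (hlA : ∀ z ∈ A, G.Reachable l z) :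
    ∃ y, {z | z ∈ A ∧ (within G Lᶜ).Reachable y z}.Infinite := by
  by_contra hcon
  push Not at hcon
  refine hA ((hL.union ((thicken_finite hlf hL).biUnion fun y _ => hcon y)).subset
    fun z hz => ?_)
  by_cases hzL : z ∈ L
  · exact Or.inl hzL
  · obtain ⟨k, hk, y, -, hky, hyz⟩ := exists_boundary_reachable hl (hlA z hz) hzL
    exact Or.inr (Set.mem_biUnion (mem_thicken_of_adj hk hky) ⟨hz, hyz⟩)

/-- The union of finitely many paths starting at `u`. -/
theorem exists_finite_connected {S : Set X} {u : X} {B : Set X} (hB : B.Finite)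
    (hr : ∀ b ∈ B, (within G S).Reachable u b) :
    ∃ K : Set X, K.Finite ∧ u ∈ K ∧ B ⊆ K ∧ (∀ z ∈ K, (within G S).Reachable u z) ∧
      ∀ z ∈ K, (within G K).Reachable u z := by
  have path : ∀ u b, (within G S).Reachable u b → ∃ K : Set X, K.Finite ∧ u ∈ K ∧ b ∈ K ∧
      (∀ z ∈ K, (within G S).Reachable u z) ∧ ∀ z ∈ K, (within G K).Reachable u z := by
    rintro u b ⟨p⟩
    induction p with
    | @nil v =>
      refine ⟨{v}, Set.finite_singleton v, rfl, rfl, ?_, ?_⟩ <;>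
      · rintro z rfl
        exact .refl _
    | @cons u v w hadj _ ih =>
      obtain ⟨K, hK, hvK, hwK, h1, h2⟩ := ih
      refine ⟨insert u K, hK.insert u, Set.mem_insert _ _, Set.mem_insert_of_mem _ hwK, ?_, ?_⟩
      · rintro z (rfl | hz)
        · exact .refl _
        · exact hadj.reachable.trans (h1 z hz)
      · rintro z (rfl | hz)
        · exact .refl _
        · have huv : (within G (insert u K)).Adj u v :=
            ⟨hadj.1, Set.mem_insert _ _, Set.mem_insert_of_mem _ hvK⟩
          exact huv.reachable.trans (reachable_within_mono (Set.subset_insert _ _) (h2 z hz))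
  choose P hP1 hP2 hP3 hP4 hP5 using fun b : B => path u b (hr b b.2)
  have := hB.to_subtype
  refine ⟨{u} ∪ ⋃ b : B, P b, (Set.finite_singleton u).union (Set.finite_iUnion hP1),
    Or.inl rfl, fun b hb => Or.inr (Set.mem_iUnion.2 ⟨⟨b, hb⟩, hP3 ⟨b, hb⟩⟩), ?_, ?_⟩
  · rintro z (rfl | hz)
    · exact .refl _
    · obtain ⟨b, hb⟩ := Set.mem_iUnion.1 hz
      exact hP4 b z hb
  · rintro z (rfl | hz)
    · exact .refl _
    · obtain ⟨b, hb⟩ := Set.mem_iUnion.1 hz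
      exact reachable_within_mono ((Set.subset_iUnion P b).trans Set.subset_union_right)
        (hP5 b z hb)

/-- A finite connected set whose removal leaves two infinite components in its component. -/
def IsSeparator (G : SimpleGraph X) (K : Set X) : Prop :=
  K.Finite ∧ (∀ a ∈ K, ∀ b ∈ K, (within G K).Reachable a b) ∧
    ∃ k ∈ K, ∃ a b, G.Reachable k a ∧ G.Reachable k b ∧ InfiniteOff G K a ∧ InfiniteOff G K b ∧
      ¬ (within G Kᶜ).Reachable a b

theorem InfiniteOff.of_forall {L L' : Set X} {y : X} (h : InfiniteOff G L y)
    (hL : ∀ w, (within G Lᶜ).Reachable y w → w ∉ L') : InfiniteOff G L' y :=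
  h.mono fun _ hz => reachable_within_of_forall hz hL

theorem InfiniteOff.notMem_of_reachable {L : Set X} {y w : X} (h : InfiniteOff G L y)
    (hw : (within G Lᶜ).Reachable y w) : w ∉ L := reachable_within_mem hw h.notMem

/-- Far out in an infinite component of the complement of a finite set that does not contain all
ends, there are separators. -/
theorem exists_separator_far (hlf : ∀ x, (G.neighborSet x).Finite) {L L1 : Set X}
    (hLL1 : L ⊆ L1) (hL1 : L1.Finite) {l u w : X} (hl : l ∈ L) (hlu : G.Reachable l u)
    (hlw : G.Reachable l w) (hu : InfiniteOff G L u) (hw : InfiniteOff G L w)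
    (huw : ¬ (within G Lᶜ).Reachable u w) (N : ℕ) :
    ∃ K, IsSeparator G K ∧ Disjoint (nbhd G K N) L1 ∧
      ∀ y ∈ nbhd G K N, (within G Lᶜ).Reachable u y := by
  set L2 := nbhd G L1 N with hL2def
  have hL2 : L2.Finite := nbhd_finite hlf hL1 N
  have hL12 : L1 ⊆ L2 := subset_nbhd L1 N
  have hlG : ∀ z, (within G Lᶜ).Reachable u z → G.Reachable l z := fun z hz =>
    hlu.trans (hz.mono (within_le _ _))
  obtain ⟨u2, hu2⟩ := exists_infinite_component hlf hL2 (hL12 (hLL1 hl)) hu hlG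
  have hcomp : (L2ᶜ : Set X) ⊆ Lᶜ := Set.compl_subset_compl.2 (hLL1.trans hL12)
  have hu2inf : InfiniteOff G L2 u2 := hu2.mono fun z hz => hz.2
  have huu2 : (within G Lᶜ).Reachable u u2 := by
    obtain ⟨z, hz1, hz2⟩ := hu2.nonempty
    exact SimpleGraph.Reachable.trans hz1 (reachable_within_mono hcomp hz2).symm
  have hU2 : ∀ z, (within G L2ᶜ).Reachable u2 z → (within G Lᶜ).Reachable u z := fun z hz =>
    huu2.trans (reachable_within_mono hcomp hz)
  -- `K` contains every point adjacent to `L2` in the component of `u2` off `L2`. It thus blocks all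
  -- exits: an infinite piece of that component left by `K` is cut off from `w`.
  obtain ⟨K, hK, huK, hBK, hKU, hKc⟩ := exists_finite_connected (G := G) (S := L2ᶜ) (u := u2)
    (B := {y | y ∈ thicken G L2 ∧ (within G L2ᶜ).Reachable u2 y})
    ((thicken_finite hlf hL2).subset fun y hy => hy.1) fun b hb => hb.2
  have hKL2 : Disjoint K L2 := Set.disjoint_left.2 fun z hz =>
    hu2inf.notMem_of_reachable (hKU z hz)
  have hKL1 : Disjoint (nbhd G K N) L1 := disjoint_nbhd_left hKL2
  refine ⟨K, ⟨hK, fun a ha b hb => (hKc a ha).symm.trans (hKc b hb), u2, huK, ?_⟩, hKL1, ?_⟩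
  · have hu2G : ∀ z, (within G L2ᶜ).Reachable u2 z → G.Reachable u2 z := fun z hz =>
      hz.mono (within_le _ _)
    obtain ⟨a, ha⟩ := exists_infinite_component hlf hK huK hu2inf hu2G
    obtain ⟨z, ⟨hz, haz⟩, hzK⟩ := (ha.sdiff hK).nonempty
    have hlu2 : G.Reachable l u2 := hlG _ huu2
    have hclosed : ∀ y, (within G Kᶜ).Reachable z y → (within G L2ᶜ).Reachable u2 y := by
      intro y hy
      refine reachable_induction (P := fun y => (within G L2ᶜ).Reachable u2 y) hy ?_ hz
      intro s t hst hs
      have ht : t ∉ L2 := fun ht => hst.2.1 (hBK ⟨mem_thicken_of_adj ht hst.1.symm, hs⟩)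
      have hadj : (within G L2ᶜ).Adj s t := ⟨hst.1, hu2inf.notMem_of_reachable hs, ht⟩
      exact hs.trans hadj.reachable
    refine ⟨a, w, ?_, hlu2.symm.trans hlw, ha.mono fun z hz => hz.2, ?_, fun haw => ?_⟩
    · exact (hu2G z hz).trans (haz.mono (within_le _ _)).symm
    · exact hw.of_forall fun t ht htK => huw ((hU2 t (hKU t htK)).trans ht.symm)
    · exact huw (hU2 w (hclosed w (haz.symm.trans haw)))
  · intro y hy
    obtain ⟨k, hk, hky⟩ := exists_reachable_nbhd N y hy
    refine (hU2 k (hKU k hk)).trans (reachable_within_mono ?_ hky)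
    exact fun t ht htL => Set.disjoint_left.1 hKL1 ht (hLL1 htL)

/-- The union of the spheres of radius `n + 1` around the members of a family of sets. -/
def shells (G : SimpleGraph X) (F : Set (Set X)) (n : ℕ) : Set X :=
  {y | ∃ K ∈ F, y ∈ nbhd G K (n + 1) ∧ y ∉ nbhd G K n}

/-- A maximal family of separators whose `N`-neighbourhoods are pairwise disjoint. -/
structure IsMaxSeparatorFamily (G : SimpleGraph X) (F : Set (Set X)) (N : ℕ) : Prop where
  isSeparator : ∀ K ∈ F, IsSeparator G K
  disjoint : ∀ K ∈ F, ∀ K' ∈ F, ∀ y, y ∈ nbhd G K N → y ∈ nbhd G K' N → K = K'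
  maximal : ∀ K', IsSeparator G K' → ∃ K ∈ F, ∃ y, y ∈ nbhd G K N ∧ y ∈ nbhd G K' N

/-- An infinite region `D` would have infinitely many points in a piece of the complement of a
finite set `L` that separates the ends. Maximality gives a member `K` of the family in this piece,
and `D`, starting in `L` outside the ball around `K`, cannot cross its sphere. So `D` stays on the
side of `K` facing `L`, and `K ∪ L` leaves three infinite pieces. -/
theorem IsMaxSeparatorFamily.finite_compl_shells {F : Set (Set X)} {N : ℕ}
    (hF : IsMaxSeparatorFamily G F N) (hlf : ∀ x, (G.neighborSet x).Finite)
    (hends : AllComponentsTwoEnded G) {n : ℕ} (hn : n + 1 ≤ N) (x : X) :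
    {y | (within G (shells G F n)ᶜ).Reachable x y}.Finite := by
  by_contra hD
  set D := {y | (within G (shells G F n)ᶜ).Reachable x y} with hDdef
  have hDinf : D.Infinite := hD
  have hDG : ∀ z ∈ D, G.Reachable x z := fun z hz => hz.mono (within_le _ _)
  obtain ⟨L0, hL0, a0, b0, hxa0, hxb0, ha0, hb0, hab0⟩ := hends.exists_separator x
  have huniv : ∀ {y z : X}, G.Reachable y z → (within G Set.univ).Reachable y z := fun h =>
    h.mono fun _ _ h' => ⟨h', trivial, trivial⟩
  obtain ⟨L, hL, hxL, hL0L, -, hLc⟩ := exists_finite_connected (G := G) (S := Set.univ) (u := x)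
    (B := {y | y ∈ L0 ∧ G.Reachable x y}) (hL0.subset fun y hy => hy.1) fun b hb => huniv hb.2
  have hLL0 : ∀ {y z}, G.Reachable x y → y ∉ L → (within G Lᶜ).Reachable y z →
      (within G L0ᶜ).Reachable y z := fun hxy hyL hyz =>
    reachable_within_of_forall hyz fun w hw hwL0 =>
      reachable_within_mem hw hyL (hL0L ⟨hwL0, hxy.trans (hw.mono (within_le _ _))⟩)
  have side : ∀ {c}, G.Reachable x c → InfiniteOff G L0 c →
      ∃ c', G.Reachable x c' ∧ InfiniteOff G L c' ∧ (within G L0ᶜ).Reachable c c' := by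
    intro c hxc hc
    obtain ⟨c', hc'⟩ := exists_infinite_component hlf hL hxL hc fun z hz =>
      hxc.trans (SimpleGraph.Reachable.mono (within_le _ _) hz)
    obtain ⟨z, hz1, hz2⟩ := hc'.nonempty
    have hinf : InfiniteOff G L c' := hc'.mono fun z hz => hz.2
    have hxc' : G.Reachable x c' :=
      (hxc.trans (SimpleGraph.Reachable.mono (within_le _ _) hz1)).trans
        (hz2.mono (within_le _ _)).symm
    exact ⟨c', hxc', hinf, SimpleGraph.Reachable.trans hz1 (hLL0 hxc' hinf.notMem hz2).symm⟩
  obtain ⟨a, hxa, ha, ha0a⟩ := side hxa0 ha0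
  obtain ⟨b, hxb, hb, hb0b⟩ := side hxb0 hb0
  have hab : ¬ (within G Lᶜ).Reachable a b := fun h =>
    hab0 ((ha0a.trans (hLL0 hxa ha.notMem h)).trans hb0b.symm)
  obtain ⟨u, huD⟩ := exists_infinite_component hlf hL hxL hDinf hDG
  have hu : InfiniteOff G L u := huD.mono fun z hz => hz.2
  have hxu : G.Reachable x u := by
    obtain ⟨z, hz1, hz2⟩ := huD.nonempty
    exact (hDG z hz1).trans (hz2.mono (within_le _ _)).symm
  obtain ⟨w, hxw, hw, huw⟩ : ∃ w, G.Reachable x w ∧ InfiniteOff G L w ∧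
      ¬ (within G Lᶜ).Reachable u w := by
    by_cases h : (within G Lᶜ).Reachable u a
    · exact ⟨b, hxb, hb, fun h' => hab (h.symm.trans h')⟩
    · exact ⟨a, hxa, ha, h⟩
  -- Also contained in `L1` are the whole `N`-neighbourhoods of the members whose `N`-neighbourhoods
  -- meet `L`, at most one for each point of `L`. A member conflicting with a separator far from
  -- `L1` then has its `N`-neighbourhood disjoint from `L`.
  let L1 : Set X := L ∪ ⋃ l ∈ L, {y | ∃ K ∈ F, l ∈ nbhd G K N ∧ y ∈ nbhd G K N}
  have hL1 : L1.Finite := by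
    refine hL.union (hL.biUnion fun l _ => ?_)
    by_cases h : ∃ K ∈ F, l ∈ nbhd G K N
    · obtain ⟨K, hK, hlK⟩ := h
      refine (nbhd_finite hlf (hF.isSeparator K hK).1 N).subset ?_
      rintro y ⟨K', hK', hlK', hy⟩
      rwa [hF.disjoint K hK K' hK' l hlK hlK']
    · refine Set.finite_empty.subset ?_
      rintro y ⟨K', hK', hlK', -⟩
      exact h ⟨K', hK', hlK'⟩
  obtain ⟨K', hK', hK'L1, hK'u⟩ := exists_separator_far hlf Set.subset_union_left hL1 hxL hxu hxw
    hu hw huw N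
  obtain ⟨K, hK, p, hpK, hpK'⟩ := hF.maximal K' hK'
  have hKL : ∀ l ∈ L, l ∉ nbhd G K N := fun l hl hlK =>
    Set.disjoint_left.1 hK'L1 hpK' (Or.inr (Set.mem_biUnion hl ⟨K, hK, hlK, hpK⟩))
  have hKN : K ⊆ nbhd G K N := subset_nbhd K N
  obtain ⟨hKfin, hKconn, k0, hk0, a', b', hk0a, hk0b, ha', hb', hab'⟩ := hF.isSeparator K hK
  have hup := hK'u p hpK'
  have hKu : ∀ k ∈ K, (within G Lᶜ).Reachable u k := by
    intro k hk
    obtain ⟨k1, hk1, hk1p⟩ := exists_reachable_nbhd N p hpK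
    have h1 : (within G Lᶜ).Reachable k1 p :=
      reachable_within_mono (fun t ht htL => hKL t htL ht) hk1p
    have h2 : (within G Lᶜ).Reachable k1 k :=
      reachable_within_mono (fun t ht htL => hKL t htL (hKN ht)) (hKconn k1 hk1 k hk)
    exact (hup.trans h1.symm).trans h2
  have hLx : ∀ l ∈ L, (within G Kᶜ).Reachable x l := fun l hl =>
    reachable_within_mono (fun t ht htK => hKL t ht (hKN htK)) (hLc l hl)
  have hwK : ∀ t, (within G Lᶜ).Reachable w t → t ∉ K := fun t ht htK =>
    huw ((hKu t htK).trans ht.symm)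
  have hxwK : (within G Kᶜ).Reachable x w := by
    obtain ⟨l, hl, y, -, hly, hyw⟩ := exists_boundary_reachable hxL hxw hw.notMem
    have hadj : (within G Kᶜ).Adj l y :=
      ⟨hly, fun h => hKL l hl (hKN h), hwK y hyw.symm⟩
    refine ((hLx l hl).trans hadj.reachable).trans ?_
    exact (reachable_within_of_forall hyw.symm hwK).symm
  obtain ⟨z, hk0z, hz, hxz⟩ : ∃ z, G.Reachable k0 z ∧ InfiniteOff G K z ∧
      ¬ (within G Kᶜ).Reachable x z := by
    by_cases h : (within G Kᶜ).Reachable x a'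
    · exact ⟨b', hk0b, hb', fun h' => hab' (h.symm.trans h')⟩
    · exact ⟨a', hk0a, ha', h⟩
  have hxGz : G.Reachable x z :=
    (hxu.trans ((hKu k0 hk0).mono (within_le _ _))).trans hk0z
  have hzKL : InfiniteOff G (K ∪ L) z := hz.of_forall fun t ht htKL => by
    rcases htKL with h | h
    · exact hz.notMem_of_reachable ht h
    · exact hxz ((hLx t h).trans ht.symm)
  have hwKL : InfiniteOff G (K ∪ L) w := hw.of_forall fun t ht htKL => by
    rcases htKL with h | h
    · exact hwK t ht h
    · exact hw.notMem_of_reachable ht h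
  have hDK : ∀ y ∈ D, y ∉ nbhd G K (n + 1) := by
    intro y hy
    refine reachable_induction (P := fun y => y ∉ nbhd G K (n + 1)) hy ?_
      fun h => hKL x hxL (nbhd_mono K hn h)
    intro s t hst hs ht
    have ht' : t ∈ nbhd G K n := by
      by_contra h
      exact hst.2.2 ⟨K, hK, ht, h⟩
    exact hs (mem_thicken_of_adj ht' hst.1.symm)
  have hDx : ∀ y ∈ D, (within G Kᶜ).Reachable x y := fun y hy =>
    reachable_within_of_forall hy fun t ht htK => hDK t ht (subset_nbhd K _ htK)
  -- `v` represents infinitely many points of `D` on the side of `u`. It is separated from `w` by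
  -- `L`, and both `v` and `w` are separated from `z` by `K`.
  obtain ⟨v, hv⟩ := exists_infinite_component hlf (hKfin.union hL) (Or.inr hxL) huD
    fun z hz => hDG z hz.1
  have hvKL : InfiniteOff G (K ∪ L) v := hv.mono fun z hz => hz.2
  obtain ⟨z1, ⟨hz1D, huz1⟩, hvz1⟩ := hv.nonempty
  have hxv : G.Reachable x v := (hDG z1 hz1D).trans (hvz1.mono (within_le _ _)).symm
  have toL : ∀ {s t}, (within G (K ∪ L)ᶜ).Reachable s t → (within G Lᶜ).Reachable s t :=
    reachable_within_mono (Set.compl_subset_compl.2 Set.subset_union_right)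
  have toK : ∀ {s t}, (within G (K ∪ L)ᶜ).Reachable s t → (within G Kᶜ).Reachable s t :=
    reachable_within_mono (Set.compl_subset_compl.2 Set.subset_union_left)
  rcases hends.not_three hlf (hKfin.union hL) (hxv.symm.trans hxw) (hxv.symm.trans hxGz)
    hvKL hwKL hzKL with h | h | h
  · exact huw ((SimpleGraph.Reachable.trans huz1 (toL hvz1).symm).trans (toL h))
  · exact hxz (((hDx z1 hz1D).trans (toK hvz1).symm).trans (toK h))
  · exact hxz (hxwK.trans (toK h))

theorem exists_mem_nbhd_of_mem_thicken_shells {F : Set (Set X)} {n : ℕ} {y : X}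
    (hy : y ∈ thicken G (thicken G (shells G F n))) :
    ∃ K ∈ F, y ∈ nbhd G K (n + 3) ∧ ∃ s, s ∉ nbhd G K n ∧ s ∈ nbhd G {y} 2 := by
  obtain ⟨t, ht, hyt⟩ := exists_mem_thicken_singleton hy
  obtain ⟨s, ⟨K, hK, hs, hs'⟩, hts⟩ := exists_mem_thicken_singleton ht
  refine ⟨K, hK, ?_, s, hs', ?_⟩
  · have h1 : t ∈ nbhd G K (n + 2) := thicken_mono (Set.singleton_subset_iff.2 hs) hts
    exact thicken_mono (Set.singleton_subset_iff.2 h1) hyt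
  · exact thicken_mono (Set.singleton_subset_iff.2 (mem_thicken_symm hyt)) (mem_thicken_symm hts)

/-- A component stays within distance `n + 3` of a single member: one more step reaches distance at
most `n + 4 ≤ N`, where the neighbourhoods of different members are still disjoint. -/
theorem IsMaxSeparatorFamily.finite_thicken_shells {F : Set (Set X)} {N : ℕ}
    (hF : IsMaxSeparatorFamily G F N) (hlf : ∀ x, (G.neighborSet x).Finite)
    {n : ℕ} (hn : n + 4 ≤ N) (x : X) :
    {y | (within G (thicken G (thicken G (shells G F n)))).Reachable x y}.Finite := by
  set S := thicken G (thicken G (shells G F n)) with hS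
  by_cases hx : x ∈ S
  · obtain ⟨K, hK, hxK, -⟩ := exists_mem_nbhd_of_mem_thicken_shells hx
    refine (nbhd_finite hlf (hF.isSeparator K hK).1 (n + 3)).subset fun y hy => ?_
    refine reachable_induction (P := fun y => y ∈ nbhd G K (n + 3)) hy ?_ hxK
    intro s t hst hs
    obtain ⟨K', hK', htK', -⟩ := exists_mem_nbhd_of_mem_thicken_shells hst.2.2
    have h1 : t ∈ nbhd G K (n + 4) := mem_thicken_of_adj hs hst.1
    rwa [hF.disjoint K hK K' hK' t (nbhd_mono K hn h1)
      (nbhd_mono K' ((n + 3).le_succ.trans hn) htK')]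
  · refine (Set.finite_singleton x).subset fun y hy => ?_
    rcases reachable_within_eq_or_mem hy with rfl | h
    · rfl
    · exact absurd h hx

/-- A common point would be within `n + 3` of a member `K` and within 2 of a point farther than `m`
from the same `K`. The gap of 5 excludes this. -/
theorem IsMaxSeparatorFamily.disjoint_thicken_shells {F : Set (Set X)} {N : ℕ}
    (hF : IsMaxSeparatorFamily G F N) {n m : ℕ} (hnm : n + 5 ≤ m) (hm : m + 4 ≤ N) :
    Disjoint (thicken G (thicken G (shells G F n))) (thicken G (thicken G (shells G F m))) := by
  rw [Set.disjoint_left]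
  intro y hn hm'
  obtain ⟨K, hK, hyK, -⟩ := exists_mem_nbhd_of_mem_thicken_shells hn
  obtain ⟨K', hK', hyK', s, hs, hsy⟩ := exists_mem_nbhd_of_mem_thicken_shells hm'
  have := hF.disjoint K hK K' hK' y (nbhd_mono K (by omega) hyK) (nbhd_mono K' (by omega) hyK')
  subst this
  refine hs (nbhd_mono K hnm ?_)
  have h1 : nbhd G {y} 2 ⊆ nbhd G K (n + 5) :=
    thicken_mono (thicken_mono (Set.singleton_subset_iff.2 hyK))
  exact h1 hsy

end Separators

/-! ### Borel construction of a maximal family of separators, and the case of finite degree -/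

section SeparatorFamily

variable {X : Type u}

/-- The finite set coded by a finite set of words at a base point. -/
def codedSet (T : ℕ → X → X) (x : X) (s : Finset (List ℕ)) : Set X :=
  {y | ∃ u ∈ s, wordMap T u x = y}

theorem codedSet_finite (T : ℕ → X → X) (x : X) (s : Finset (List ℕ)) :
    (codedSet T x s).Finite :=
  s.finite_toSet.image fun u => wordMap T u x

/-- The `N`-neighbourhoods of two coded sets meet. -/
def Conflict (G : SimpleGraph X) (T : ℕ → X → X) (N : ℕ) (s t : Finset (List ℕ))
    (x y : X) : Prop :=
  ∃ z, z ∈ nbhd G (codedSet T x s) N ∧ z ∈ nbhd G (codedSet T y t) N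

theorem Conflict.symm {G : SimpleGraph X} {T : ℕ → X → X} {N : ℕ} {s t : Finset (List ℕ)}
    {x y : X} (h : Conflict G T N s t x y) : Conflict G T N t s y x :=
  h.imp fun _ hz => hz.symm

variable [MeasurableSpace X] {G : SimpleGraph X} {T : ℕ → X → X}

theorem IsGenerating.reachable_of_mem_nbhd (hT : IsGenerating G T) {x y : X}
    {s : Finset (List ℕ)} {n : ℕ} (h : y ∈ nbhd G (codedSet T x s) n) : G.Reachable x y := by
  obtain ⟨k, ⟨u, -, rfl⟩, hk⟩ := exists_reachable_nbhd n y h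
  exact (hT.reachable_wordMap u x).trans (hk.mono (within_le _ _))

theorem Conflict.reachable (hT : IsGenerating G T) {N : ℕ} {s t : Finset (List ℕ)} {x y : X}
    (h : Conflict G T N s t x y) : G.Reachable x y := by
  obtain ⟨z, h1, h2⟩ := h
  exact (hT.reachable_of_mem_nbhd h1).trans (hT.reachable_of_mem_nbhd h2).symm

theorem IsGenerating.exists_codedSet_eq (hT : IsGenerating G T) {x : X} {K : Set X}
    (hK : K.Finite) (hr : ∀ y ∈ K, G.Reachable x y) : ∃ s, codedSet T x s = K := by
  classical
  choose w hw using fun y : K => hT.exists_wordMap (hr y y.2)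
  have := hK.fintype
  refine ⟨Finset.univ.image w, ?_⟩
  ext y
  constructor
  · rintro ⟨u, hu, rfl⟩
    obtain ⟨z, -, rfl⟩ := Finset.mem_image.1 hu
    rw [hw]
    exact z.2
  · intro hy
    exact ⟨w ⟨y, hy⟩, Finset.mem_image_of_mem _ (Finset.mem_univ _), hw _⟩

section Measurability

variable [MeasurableEq X]

theorem IsGenerating.measurable_mem_nbhd (hT : IsGenerating G T) (s : Finset (List ℕ)) (n : ℕ) :
    Measurable fun p : X × X => p.2 ∈ nbhd G (codedSet T p.1 s) n := by
  induction n with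
  | zero =>
    exact Measurable.exists fun u => measurable_const.and
      (((hT.measurable_wordMap u).comp measurable_fst).eq measurable_snd)
  | succ n ih =>
    simp only [nbhd, hT.mem_thicken_iff]
    exact ih.or (Measurable.exists fun k =>
      ih.comp (measurable_fst.prodMk ((hT.measurable k).comp measurable_snd)))

theorem IsGenerating.measurable_conflict (hT : IsGenerating G T) (N : ℕ)
    (s t : Finset (List ℕ)) : Measurable fun p : X × X => Conflict G T N s t p.1 p.2 := by
  have : ∀ p : X × X, Conflict G T N s t p.1 p.2 ↔
      ∃ w, wordMap T w p.1 ∈ nbhd G (codedSet T p.1 s) N ∧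
        wordMap T w p.1 ∈ nbhd G (codedSet T p.2 t) N := by
    intro p
    constructor
    · rintro ⟨z, hz, hz'⟩
      obtain ⟨w, rfl⟩ := hT.exists_wordMap (hT.reachable_of_mem_nbhd hz)
      exact ⟨w, hz, hz'⟩
    · rintro ⟨w, h⟩
      exact ⟨_, h⟩
  simp only [this]
  refine Measurable.exists fun w => ?_
  have hw : Measurable fun p : X × X => wordMap T w p.1 :=
    (hT.measurable_wordMap w).comp measurable_fst
  exact ((hT.measurable_mem_nbhd s N).comp (measurable_fst.prodMk hw)).and
    ((hT.measurable_mem_nbhd t N).comp (measurable_snd.prodMk hw))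

/-- Infinite means not contained in any finite set, and the finite subsets of a component are coded
by the countably many finite sets of words. -/
theorem IsGenerating.measurable_infinite (hT : IsGenerating G T) {P : X → X → Prop}
    (hP : Measurable fun p : X × X => P p.1 p.2) (hr : ∀ x y, P x y → G.Reachable x y) :
    Measurable fun x => {y | P x y}.Infinite := by
  have : ∀ x, {y | P x y}.Infinite ↔ ∀ t : Finset (List ℕ), ∃ w, P x (wordMap T w x) ∧
      ∀ v, v ∈ t → ¬ wordMap T v x = wordMap T w x := by
    intro x
    constructor
    · intro h t
      obtain ⟨y, hy, hyt⟩ := (h.sdiff (codedSet_finite T x t)).nonempty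
      obtain ⟨w, rfl⟩ := hT.exists_wordMap (hr x y hy)
      exact ⟨w, hy, fun v hv hvw => hyt ⟨v, hv, hvw⟩⟩
    · intro h hfin
      obtain ⟨t, ht⟩ := hT.exists_codedSet_eq hfin (hr x)
      obtain ⟨w, hw, hwt⟩ := h t
      have h1 : wordMap T w x ∈ codedSet T x t := by rw [ht]; exact hw
      obtain ⟨v, hv, hvw⟩ := h1
      exact hwt v hv hvw
  simp only [this]
  refine Measurable.forall fun t => Measurable.exists fun w => Measurable.and ?_
    (Measurable.forall fun v => measurable_const.imp
      ((hT.measurable_wordMap v).eq (hT.measurable_wordMap w)).not)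
  exact hP.comp (measurable_id.prodMk (hT.measurable_wordMap w))

theorem IsGenerating.measurable_isSeparator (hT : IsGenerating G T) (hG : IsBorelGraph G)
    (s : Finset (List ℕ)) : Measurable fun x => IsSeparator G (codedSet T x s) := by
  have hm := hT.measurable_wordMap
  have hmem : Measurable fun p : X × X => p.2 ∈ codedSet T p.1 s := hT.measurable_mem_nbhd s 0
  have hadj : Measurable fun p : X × X × X => G.Adj p.2.1 p.2.2 :=
    hG.adj (measurable_fst.comp measurable_snd) (measurable_snd.comp measurable_snd)
  have hmem1 : Measurable fun p : X × X × X => p.2.1 ∈ codedSet T p.1 s :=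
    hmem.comp (measurable_fst.prodMk (measurable_fst.comp measurable_snd))
  have hmem2 : Measurable fun p : X × X × X => p.2.2 ∈ codedSet T p.1 s :=
    hmem.comp (measurable_fst.prodMk (measurable_snd.comp measurable_snd))
  have hin : Measurable fun p : X × X × X =>
      (within G (codedSet T p.1 s)).Reachable p.2.1 p.2.2 :=
    hT.measurable_reachable_family (H := fun x => within G (codedSet T x s))
      (hadj.and (hmem1.and hmem2)) fun _ => within_le _ _
  have hoff : Measurable fun p : X × X × X =>
      (within G (codedSet T p.1 s)ᶜ).Reachable p.2.1 p.2.2 :=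
    hT.measurable_reachable_family (H := fun x => within G (codedSet T x s)ᶜ)
      (hadj.and (hmem1.not.and hmem2.not)) fun _ => within_le _ _
  have hinf : ∀ v, Measurable fun x => InfiniteOff G (codedSet T x s) (wordMap T v x) := by
    intro v
    refine hT.measurable_infinite
      (P := fun x y => (within G (codedSet T x s)ᶜ).Reachable (wordMap T v x) y) ?_ ?_
    · exact hoff.comp (measurable_fst.prodMk (((hm v).comp measurable_fst).prodMk measurable_snd))
    · exact fun x y h => (hT.reachable_wordMap v x).trans (h.mono (within_le _ _))
  have hiff : ∀ x, IsSeparator G (codedSet T x s) ↔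
      (∀ u, u ∈ s → ∀ v, v ∈ s →
        (within G (codedSet T x s)).Reachable (wordMap T u x) (wordMap T v x)) ∧
      s.Nonempty ∧ ∃ v w, InfiniteOff G (codedSet T x s) (wordMap T v x) ∧
        InfiniteOff G (codedSet T x s) (wordMap T w x) ∧
        ¬ (within G (codedSet T x s)ᶜ).Reachable (wordMap T v x) (wordMap T w x) := by
    intro x
    constructor
    · rintro ⟨-, hc, k, ⟨u, hu, rfl⟩, a, b, hka, hkb, h⟩
      obtain ⟨v, rfl⟩ := hT.exists_wordMap ((hT.reachable_wordMap u x).trans hka)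
      obtain ⟨w, rfl⟩ := hT.exists_wordMap ((hT.reachable_wordMap u x).trans hkb)
      exact ⟨fun u hu v hv => hc _ ⟨u, hu, rfl⟩ _ ⟨v, hv, rfl⟩, ⟨u, hu⟩, v, w, h⟩
    · rintro ⟨hc, ⟨u, hu⟩, v, w, h⟩
      refine ⟨codedSet_finite T x s, ?_, _, ⟨u, hu, rfl⟩, _, _, ?_, ?_, h⟩
      · rintro _ ⟨u, hu, rfl⟩ _ ⟨v, hv, rfl⟩
        exact hc u hu v hv
      · exact (hT.reachable_wordMap u x).symm.trans (hT.reachable_wordMap v x)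
      · exact (hT.reachable_wordMap u x).symm.trans (hT.reachable_wordMap w x)
  simp only [hiff]
  refine Measurable.and (Measurable.forall fun u => measurable_const.imp
    (Measurable.forall fun v => measurable_const.imp ?_)) (measurable_const.and
      (Measurable.exists fun v => Measurable.exists fun w => (hinf v).and ((hinf w).and ?_)))
  · exact hin.comp (measurable_id.prodMk ((hm u).prodMk (hm v)))
  · exact (hoff.comp (measurable_id.prodMk ((hm v).prodMk (hm w)))).not

end Measurability

/-- A conflict puts a word value of `y` in a fixed finite ball around the set coded at `x`. Word
maps are injective, so only finitely many `y` qualify. -/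
theorem IsGenerating.finite_conflict (hT : IsGenerating G T)
    (hlf : ∀ x, (G.neighborSet x).Finite) (N : ℕ) (s : Finset (List ℕ)) (x : X) :
    {y | Conflict G T N s s x y}.Finite := by
  set B := nbhd G (nbhd G (codedSet T x s) N) N
  have hB : B.Finite := nbhd_finite hlf (nbhd_finite hlf (codedSet_finite T x s) N) N
  refine (s.finite_toSet.biUnion fun u _ =>
    hB.preimage ((hT.injective_wordMap u).injOn)).subset ?_
  rintro y ⟨z, hz, hz'⟩
  by_contra hy
  refine Set.disjoint_left.1 (disjoint_nbhd_left (G := G) (A := codedSet T y s)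
    (B := nbhd G (codedSet T x s) N) (n := N) (Set.disjoint_left.2 ?_)) hz' hz
  rintro _ ⟨u, hu, rfl⟩ huB
  exact hy (Set.mem_biUnion (Finset.mem_coe.2 hu) huB)

variable [StandardBorelSpace X]

/-- There is a maximal family of separators that are far apart, with Borel shells. -/
theorem IsGenerating.exists_isMaxSeparatorFamily (hT : IsGenerating G T) (hG : IsBorelGraph G)
    (hlf : ∀ x, (G.neighborSet x).Finite) (N : ℕ) :
    ∃ F, IsMaxSeparatorFamily G F N ∧ ∀ n, MeasurableSet (shells G F n) := by
  classical
  obtain ⟨φ, hφ⟩ := exists_measurableEmbedding_real X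
  obtain ⟨e, he⟩ := exists_surjective_nat (Finset (List ℕ) × (ℚ × ℚ))
  let V : ℕ → X → Prop := fun n x => IsSeparator G (codedSet T x (e n).1) ∧
    ((e n).2.1 : ℝ) < φ x ∧ φ x < (e n).2.2
  -- Stage `n` treats one code and one rational interval. Only base points without a conflicting
  -- rival at the same stage are candidates, so all of them can be added simultaneously unless they
  -- conflict with sets added earlier.
  let Cand : ℕ → X → Prop := fun n x => V n x ∧ ∀ w, ¬ wordMap T w x = x →
    V n (wordMap T w x) → ¬ Conflict G T N (e n).1 (e n).1 x (wordMap T w x)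
  let Used : ℕ → Finset (List ℕ) → X → Prop := fun n => Nat.rec (fun _ _ => False)
    (fun n U t x => U t x ∨ t = (e n).1 ∧ Cand n x ∧
      ∀ t' w, U t' (wordMap T w x) → ¬ Conflict G T N t t' x (wordMap T w x)) n
  have hUsed : ∀ n t x, Used (n + 1) t x ↔ Used n t x ∨ t = (e n).1 ∧ Cand n x ∧
      ∀ t' w, Used n t' (wordMap T w x) → ¬ Conflict G T N t t' x (wordMap T w x) :=
    fun n t x => Iff.rfl
  have hm := hT.measurable_wordMap
  have hVm : ∀ n, Measurable (V n) := by
    intro n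
    refine (hT.measurable_isSeparator hG _).and (Measurable.and ?_ ?_)
    · exact measurableSet_setOfPred.1 (measurableSet_lt measurable_const hφ.measurable)
    · exact measurableSet_setOfPred.1 (measurableSet_lt hφ.measurable measurable_const)
  have hCm : ∀ s t w, Measurable fun x => Conflict G T N s t x (wordMap T w x) := fun s t w =>
    (hT.measurable_conflict N s t).comp (measurable_id.prodMk (hm w))
  have hCandm : ∀ n, Measurable (Cand n) := fun n =>
    (hVm n).and (Measurable.forall fun w => ((hm w).eq measurable_id).not.imp
      (((hVm n).comp (hm w)).imp (hCm _ _ w).not))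
  have hUsedm : ∀ n t, Measurable (Used n t) := by
    intro n
    induction n with
    | zero => exact fun t => measurable_const
    | succ n ih =>
      exact fun t => (ih t).or (measurable_const.and ((hCandm n).and
        (Measurable.forall fun t' => Measurable.forall fun w =>
          ((ih t').comp (hm w)).imp (hCm _ _ w).not)))
  have hsep : ∀ n t x, Used n t x → IsSeparator G (codedSet T x t) := by
    intro n
    induction n with
    | zero => exact fun t x h => h.elim
    | succ n ih =>
      rintro t x (h | ⟨rfl, h, -⟩)
      · exact ih t x h
      · exact h.1.1
  have hmono : ∀ {n m}, n ≤ m → ∀ t x, Used n t x → Used m t x := by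
    intro n m hnm
    induction hnm with
    | refl => exact fun _ _ h => h
    | step _ ih => exact fun t x h => Or.inl (ih t x h)
  have hdisj : ∀ n t x t' y, Used n t x → Used n t' y → Conflict G T N t t' x y →
      t = t' ∧ x = y := by
    intro n
    induction n with
    | zero => exact fun t x t' y h => h.elim
    | succ n ih =>
      rintro t x t' y (h | ⟨rfl, h, h1⟩) (h' | ⟨rfl, h', h1'⟩) hc
      · exact ih t x t' y h h' hc
      · obtain ⟨w, rfl⟩ := hT.exists_wordMap (hc.symm.reachable hT)
        exact absurd hc.symm (h1' t w h)
      · obtain ⟨w, rfl⟩ := hT.exists_wordMap (hc.reachable hT)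
        exact absurd hc (h1 t' w h')
      · obtain ⟨w, rfl⟩ := hT.exists_wordMap (hc.reachable hT)
        refine ⟨rfl, ?_⟩
        by_contra hne
        exact h.2 w (fun h => hne h.symm) h'.1 hc
  refine ⟨{K | ∃ n t x, Used n t x ∧ codedSet T x t = K}, ⟨?_, ?_, ?_⟩, fun n => ?_⟩
  · rintro _ ⟨n, t, x, h, rfl⟩
    exact hsep n t x h
  · rintro _ ⟨n, t, x, h, rfl⟩ _ ⟨n', t', x', h', rfl⟩ y hy hy'
    obtain ⟨rfl, rfl⟩ := hdisj (max n n') t x t' x' (hmono (le_max_left _ _) _ _ h)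
      (hmono (le_max_right _ _) _ _ h') ⟨y, hy, hy'⟩
    rfl
  · intro K' hK'
    obtain ⟨hfin, hconn, k, hk, -⟩ := id hK'
    obtain ⟨s, rfl⟩ := hT.exists_codedSet_eq hfin fun y hy =>
      (hconn k hk y hy).mono (within_le _ _)
    -- The rivals of `k` for the code `s` are finitely many, so some rational interval isolates `φ
    -- k` from them. At the corresponding stage `k` is a candidate, and its set is either added or
    -- blocked by an earlier one.
    have hE : ({y | Conflict G T N s s k y} \ {k}).Finite := (hT.finite_conflict hlf N s k).sdiff
    obtain ⟨p, q, hpq, hpqE⟩ : ∃ p q : ℚ, ((p : ℝ) < φ k ∧ φ k < q) ∧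
        ∀ y ∈ {y | Conflict G T N s s k y} \ {k}, ¬ ((p : ℝ) < φ y ∧ φ y < q) := by
      have hopen : (φ '' ({y | Conflict G T N s s k y} \ {k}))ᶜ ∈ nhds (φ k) := by
        refine (hE.image φ).isClosed.isOpen_compl.mem_nhds ?_
        rintro ⟨y, hy, hyk⟩
        exact hy.2 (hφ.injective hyk)
      obtain ⟨a, b, hab, hsub⟩ := mem_nhds_iff_exists_Ioo_subset.1 hopen
      obtain ⟨p, hp⟩ := exists_rat_btwn hab.1
      obtain ⟨q, hq⟩ := exists_rat_btwn hab.2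
      exact ⟨p, q, ⟨hp.2, hq.1⟩, fun y hy h =>
        hsub ⟨hp.1.trans h.1, h.2.trans hq.2⟩ ⟨y, hy, rfl⟩⟩
    obtain ⟨n, hn⟩ := he (s, (p, q))
    have hcand : Cand n k := by
      refine ⟨⟨by rw [hn]; exact hK', by rw [hn]; exact hpq⟩, fun w hne hV hc => ?_⟩
      rw [hn] at hc
      have hV2 := hV.2
      rw [hn] at hV2
      exact hpqE _ ⟨hc, hne⟩ hV2
    rcases Classical.em (∀ (t' : Finset (List ℕ)) (w : List ℕ), Used n t' (wordMap T w k) →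
        ¬ Conflict G T N s t' k (wordMap T w k)) with hfree | hfree
    · have : Used (n + 1) s k := Or.inr ⟨by rw [hn], hcand, hfree⟩
      exact ⟨_, ⟨n + 1, s, k, this, rfl⟩, k, subset_nbhd _ _ hk, subset_nbhd _ _ hk⟩
    · push Not at hfree
      obtain ⟨t', w, hU, z, hz, hz'⟩ := hfree
      exact ⟨_, ⟨n, t', _, hU, rfl⟩, z, hz', hz⟩
  · have hiff : shells G {K | ∃ n t x, Used n t x ∧ codedSet T x t = K} n =
        {y | ∃ m t w, Used m t (wordMap T w y) ∧
          y ∈ nbhd G (codedSet T (wordMap T w y) t) (n + 1) ∧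
          ¬ y ∈ nbhd G (codedSet T (wordMap T w y) t) n} := by
      ext y
      constructor
      · rintro ⟨_, ⟨m, t, x, hU, rfl⟩, hy, hy'⟩
        obtain ⟨w, rfl⟩ := hT.exists_wordMap (hT.reachable_of_mem_nbhd hy).symm
        exact ⟨m, t, w, hU, hy, hy'⟩
      · rintro ⟨m, t, w, hU, h⟩
        exact ⟨_, ⟨m, t, _, hU, rfl⟩, h⟩
    rw [hiff]
    refine measurableSet_setOfPred.2 (Measurable.exists fun m => Measurable.exists fun t =>
      Measurable.exists fun w => ((hUsedm m t).comp (hm w)).and (Measurable.and ?_ ?_))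
    · exact (hT.measurable_mem_nbhd t (n + 1)).comp ((hm w).prodMk measurable_id)
    · exact ((hT.measurable_mem_nbhd t n).comp ((hm w).prodMk measurable_id)).not

/-- The bound on the Borel edge chromatic number for graphs of finite maximum degree. -/
theorem borelEdgeChromaticNumber_le_of_finite (hG : IsBorelGraph G) (hbip : G.IsBipartite)
    (hends : AllComponentsTwoEnded G) (hfin : supDegree G < Cardinal.aleph0) :
    borelEdgeChromaticNumber G ≤ supDegree G + 1 := by
  obtain ⟨d, hd⟩ := Cardinal.lt_aleph0.1 hfin
  have hdeg : ∀ x, (G.neighborSet x).encard ≤ d := by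
    intro x
    have h1 := (mk_neighborSet_le_supDegree G x).trans hd.le
    rw [Set.encard, ENat.card]
    simpa using Cardinal.toENat_le_iff_of_le_aleph0 (h1.trans (Cardinal.natCast_lt_aleph0.le)) |>.2 h1
  have hlf : ∀ x, (G.neighborSet x).Finite := fun x => Set.finite_of_encard_le_coe (hdeg x)
  obtain ⟨T, hT⟩ := exists_isGenerating hG fun x => (hlf x).countable
  -- The cut sets are the shells of parameters `5 * i` with `i < d`. Spacing 5 keeps their double
  -- thickenings disjoint, and `N = 5 * d + 4` leaves the required margin of 4 beyond the largest
  -- parameter.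
  obtain ⟨F, hF, hFm⟩ := hT.exists_isMaxSeparatorFamily hG hlf (5 * d + 4)
  rw [hd]
  refine csInf_le' ?_
  have := hT.hasBorelEdgeColoring_of_cutSets hG hbip hdeg (C := fun i => shells G F (5 * i))
    (fun i hi => ⟨hFm _, hF.finite_compl_shells hlf hends (by omega),
      hF.finite_thicken_shells hlf (by omega)⟩)
    (fun i hi j hj hij => by
      rcases lt_or_gt_of_ne hij with h | h
      · exact hF.disjoint_thicken_shells (by omega) (by omega)
      · exact (hF.disjoint_thicken_shells (by omega) (by omega)).symm)
  simpa using this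

end SeparatorFamily

end BorelGraph

theorem theorem3 {X : Type*} [TopologicalSpace X] [PolishSpace X] [MeasurableSpace X]
    [BorelSpace X] (G : SimpleGraph X) (hG : BorelGraph.IsBorelGraph G)
    (hbip : G.IsBipartite) (hends : BorelGraph.AllComponentsTwoEnded G) :
    BorelGraph.borelEdgeChromaticNumber G ≤ BorelGraph.supDegree G + 1 := by
  rcases lt_or_ge (BorelGraph.supDegree G) Cardinal.aleph0 with h | h
  · exact BorelGraph.borelEdgeChromaticNumber_le_of_finite hG hbip hends h
  · exact (BorelGraph.borelEdgeChromaticNumber_le_of_infinite hG h).trans (self_le_add_right _ _)
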